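/- **Theorem 1.2.** Let $P$ be a perfect group (finite or infinite) generated by an element $\mu$ of order $2$ and an element $\lambda$ of order $3$. Let $G=P\wr \mathrm{A}_5=P^5{:}\mathrm{A}_5$, where permutations are composed from left to right, $i^\pi$ denotes the image of the point $i$ under $\pi$, and $$\pi\,(t_1,t_2,t_3,t_4,t_5)\,\pi^{-1}=(t_{1^\pi},t_{2^\pi},t_{3^\pi},t_{4^\pi},t_{5^\pi})\qquad\text{for }(t_1,\dots,t_5)\in P^5,\ \pi\in \mathrm{A}_5 .$$ Put $$h_1=(1,1,1,\lambda,\lambda^{-1})(1\,2\,3),\qquad h_2=(\mu,\mu,\mu,1,1)(1\,2)(4\,5),\qquad g=(1,\mu,1,1,\mu)(1\,4)(2\,5),$$ and $H=\langle h_1,h_2\rangle\le G$. Let $\Gamma=\mathrm{Cos}(G,H,HgH)$ be the graph whose vertices are the right cosets $Hx$ $(x\in G)$, with $Hx$ adjacent to $Hy$ if and only if $yx^{-1}\in HgH$; this relation is symmetric and irreflexive. The group $G$ acts on $\Gamma$ by right multiplication, and the following hold. * $\Gamma$ is connected and cubic, and $(G,2)$-arc-transitive: $G$ is transitive on the set of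 $2$-arcs, that is, of triples $(v_0,v_1,v_2)$ of pairwise distinct vertices with $v_0\sim v_1\sim v_2$. * $\Gamma$ is a normal cover of the Petersen graph with transformation group $N=P^5$: the normal subgroup $N$ of $G$ has at least three orbits on vertices; the quotient graph $\Gamma_N$, whose vertices are the $N$-orbits, two distinct orbits being adjacent if some vertex of one is adjacent to some vertex of the other, is isomorphic to the Petersen graph; and the map sending each vertex to its $N$-orbit maps the neighbourhood of each vertex bijectively onto the neighbourhood of its image. * (i) $\mathsf{Aut}(\Gamma)=G$, that is, the action of $G$ by right multiplication is an isomorphism of $G$ onto $\mathsf{Aut}(\Gamma)$. * (ii) $\Gamma$ is not isomorphic to a Cayley graph of any group. * (iii) $\Gamma$ has girth $10$. -/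

import Mathlib

open scoped Pointwise

namespace PetersenCover

universe u v

/-! ### Arcs, arc-transitivity, normal quotients and normal covers -/

section Graphs

variable {V : Type u} {W : Type v}

/-- An `s`-arc: `s + 1` vertices, consecutive ones adjacent and any three consecutive ones
distinct (adjacent vertices are automatically distinct). -/
def IsSArc (Γ : SimpleGraph V) (s : ℕ) (a : Fin (s + 1) → V) : Prop :=
  (∀ i : Fin s, Γ.Adj (a i.castSucc) (a i.succ)) ∧
    ∀ i j : Fin (s + 1), (j : ℕ) = i + 2 → a i ≠ a j

/-- `Γ` is `(A, s)`-arc-transitive: the group `A` of automorphisms of `Γ` is transitive on the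
set of `s`-arcs of `Γ`. -/
def IsSArcTransitive (Γ : SimpleGraph V) (A : Subgroup (Γ ≃g Γ)) (s : ℕ) : Prop :=
  ∀ a b : Fin (s + 1) → V, IsSArc Γ s a → IsSArc Γ s b → ∃ x ∈ A, ∀ i, x (a i) = b i

/-- The normal quotient `Γ_N`: its vertices are the `N`-orbits, and two (distinct) orbits are
adjacent when some vertex of one is adjacent to some vertex of the other. -/
def normalQuotient (Γ : SimpleGraph V) (N : Subgroup (Γ ≃g Γ)) :
    SimpleGraph (MulAction.orbitRel.Quotient N V) where
  Adj p q := p ≠ q ∧ ∃ a b : V, Quotient.mk _ a = p ∧ Quotient.mk _ b = q ∧ Γ.Adj a b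
  symm := ⟨fun _ _ ⟨hne, a, b, ha, hb, hab⟩ => ⟨hne.symm, b, a, hb, ha, hab.symm⟩⟩
  loopless := ⟨fun _ h => h.1 rfl⟩

/-- `Γ` is a normal `N`-cover of `Δ` with respect to the group `A` of automorphisms: `N` is a
normal subgroup of `A` with at least three orbits, the quotient graph `Γ_N` is isomorphic to `Δ`,
and the quotient map is a bijection from the neighbourhood of each vertex onto the neighbourhood
of its image (so that valencies are preserved). -/
structure IsNormalCover (Γ : SimpleGraph V) (A N : Subgroup (Γ ≃g Γ)) (Δ : SimpleGraph W) :
    Prop where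
  le : N ≤ A
  normal : (N.subgroupOf A).Normal
  three_le_orbits : 3 ≤ ENat.card (MulAction.orbitRel.Quotient N V)
  quotient_iso : Nonempty (normalQuotient Γ N ≃g Δ)
  bijOn_neighborSet : ∀ a : V,
    Set.BijOn (fun b : V => (Quotient.mk _ b : MulAction.orbitRel.Quotient N V))
      (Γ.neighborSet a) ((normalQuotient Γ N).neighborSet (Quotient.mk _ a))

/-- `Γ` is (isomorphic to) a Cayley graph. The group has the cardinality of the vertex set, so
it is no restriction to look for it in the universe of the vertices. -/
def IsCayleyGraph (Γ : SimpleGraph V) : Prop :=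
  ∃ (K : Type u) (_ : Group K) (S : Set K), Nonempty (Γ ≃g SimpleGraph.mulCayley S)

/-- The Petersen graph: the 2-subsets of a 5-set, adjacent when disjoint. -/
def petersenGraph : SimpleGraph {s : Finset (Fin 5) // s.card = 2} where
  Adj s t := Disjoint s.1 t.1
  symm := ⟨fun _ _ h => h.symm⟩
  loopless := ⟨fun s h => by
    have h0 : s.1 = ∅ := disjoint_self.mp h
    have h2 := s.2
    rw [h0] at h2
    simp at h2⟩

end Graphs

/-! ### Coset graphs -/

section CosetGraph

variable {G : Type u} [Group G]

/-- The set `[G : H]` of right cosets `H x`. -/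
abbrev RightCosets (H : Subgroup G) : Type u := Quotient (QuotientGroup.rightRel H)

/-- The coset graph `Cos(G, H, HgH)`: the vertices are the right cosets of `H`, and `Hx ∼ Hy` when
`y x⁻¹ ∈ HgH`. The two hypotheses say that this relation is symmetric and irreflexive. -/
def cosetGraph (H : Subgroup G) (g : G) (hsymm : g⁻¹ ∈ DoubleCoset.doubleCoset g (H : Set G) H)
    (hg : g ∉ H) : SimpleGraph (RightCosets H) where
  Adj p q := ∃ x y : G, Quotient.mk _ x = p ∧ Quotient.mk _ y = q ∧
    y * x⁻¹ ∈ DoubleCoset.doubleCoset g (H : Set G) H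
  symm := ⟨by
    rintro _ _ ⟨x, y, rfl, rfl, h⟩
    refine ⟨y, x, rfl, rfl, ?_⟩
    rw [DoubleCoset.mem_doubleCoset] at h hsymm ⊢
    obtain ⟨a, ha, b, hb, hab⟩ := h
    obtain ⟨c, hc, d, hd, hcd⟩ := hsymm
    refine ⟨b⁻¹ * c, H.mul_mem (H.inv_mem hb) hc, d * a⁻¹, H.mul_mem hd (H.inv_mem ha), ?_⟩
    calc x * y⁻¹ = (y * x⁻¹)⁻¹ := by group
      _ = b⁻¹ * g⁻¹ * a⁻¹ := by rw [hab]; group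
      _ = b⁻¹ * c * g * (d * a⁻¹) := by rw [hcd]; group⟩
  loopless := ⟨by
    rintro _ ⟨x, y, rfl, hy, h⟩
    have hr : x * y⁻¹ ∈ H := QuotientGroup.rightRel_apply.mp (Quotient.exact hy)
    rw [DoubleCoset.mem_doubleCoset] at h
    obtain ⟨a, ha, b, hb, hab⟩ := h
    apply hg
    have : g = a⁻¹ * (x * y⁻¹)⁻¹ * b⁻¹ := by
      have : (x * y⁻¹)⁻¹ = a * g * b := by rw [← hab]; group
      rw [this]; group
    rw [this]
    exact H.mul_mem (H.mul_mem (H.inv_mem ha) (H.inv_mem hr)) (H.inv_mem hb)⟩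

/-- Adjacency of two cosets does not depend on the representatives. -/
theorem cosetGraph_adj_mk (H : Subgroup G) (g : G)
    (hsymm : g⁻¹ ∈ DoubleCoset.doubleCoset g (H : Set G) H) (hg : g ∉ H) (x y : G) :
    (cosetGraph H g hsymm hg).Adj (Quotient.mk _ x) (Quotient.mk _ y) ↔
      y * x⁻¹ ∈ DoubleCoset.doubleCoset g (H : Set G) H := by
  refine ⟨?_, fun h => ⟨x, y, rfl, rfl, h⟩⟩
  rintro ⟨x', y', hx, hy, h⟩
  have h1 : x * x'⁻¹ ∈ H := QuotientGroup.rightRel_apply.mp (Quotient.exact hx)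
  have h2 : y * y'⁻¹ ∈ H := QuotientGroup.rightRel_apply.mp (Quotient.exact hy)
  rw [DoubleCoset.mem_doubleCoset] at h ⊢
  obtain ⟨a, ha, b, hb, hab⟩ := h
  refine ⟨y * y'⁻¹ * a, H.mul_mem h2 ha, b * (x * x'⁻¹)⁻¹, H.mul_mem hb (H.inv_mem h1), ?_⟩
  calc y * x⁻¹ = y * y'⁻¹ * (y' * x'⁻¹) * (x * x'⁻¹)⁻¹ := by group
    _ = y * y'⁻¹ * a * g * (b * (x * x'⁻¹)⁻¹) := by rw [hab]; group

/-- Right multiplication by `z` on the right cosets: `Hx ↦ Hxz`. -/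
def cosetMul (H : Subgroup G) (z : G) : RightCosets H → RightCosets H :=
  Quotient.map (fun x => x * z) fun x y h => by
    have h' : y * x⁻¹ ∈ H := QuotientGroup.rightRel_apply.mp h
    refine QuotientGroup.rightRel_apply.mpr ?_
    have : y * z * (x * z)⁻¹ = y * x⁻¹ := by group
    rwa [this]

/-- The action of `G` on `Cos(G, H, HgH)` by right multiplication, as a homomorphism into the
automorphism group; since Mathlib composes automorphisms from right to left,
`z` is sent to `Hx ↦ Hxz⁻¹`. -/
def cosetAction (H : Subgroup G) (g : G)
    (hsymm : g⁻¹ ∈ DoubleCoset.doubleCoset g (H : Set G) H) (hg : g ∉ H) :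
    G →* (cosetGraph H g hsymm hg ≃g cosetGraph H g hsymm hg) where
  toFun z :=
    { toFun := cosetMul H z⁻¹
      invFun := cosetMul H z
      left_inv := by
        rintro ⟨x⟩
        exact congrArg (Quotient.mk _) (by group : x * z⁻¹ * z = x)
      right_inv := by
        rintro ⟨x⟩
        exact congrArg (Quotient.mk _) (by group : x * z * z⁻¹ = x)
      map_rel_iff' := by
        rintro ⟨x⟩ ⟨y⟩
        refine (cosetGraph_adj_mk H g hsymm hg (x * z⁻¹) (y * z⁻¹)).trans
          (Iff.trans ?_ (cosetGraph_adj_mk H g hsymm hg x y).symm)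
        have : y * z⁻¹ * (x * z⁻¹)⁻¹ = y * x⁻¹ := by group
        rw [this] }
  map_one' := by
    ext ⟨x⟩
    exact congrArg (Quotient.mk _) (by group : x * (1 : G)⁻¹ = x)
  map_mul' z w := by
    ext ⟨x⟩
    exact congrArg (Quotient.mk _) (by group : x * (z * w)⁻¹ = x * w⁻¹ * z⁻¹)

end CosetGraph

/-! ### The wreath product `P ≀ A₅` and the graph -/

section Construction

variable (P : Type u) [Group P]

/-- `π ∈ A₅` acts on `P⁵` by permuting coordinates: `(π • t) i = t (π⁻¹ i)`. -/
def permAction : alternatingGroup (Fin 5) →* MulAut (Fin 5 → P) where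
  toFun π :=
    { toFun := fun t i => t ((π : Equiv.Perm (Fin 5))⁻¹ i)
      invFun := fun t i => t ((π : Equiv.Perm (Fin 5)) i)
      left_inv := fun t => by ext i; simp
      right_inv := fun t => by ext i; simp
      map_mul' := fun _ _ => rfl }
  map_one' := by
    ext t i
    rfl
  map_mul' π σ := by
    ext t i
    rfl

/-- The wreath product `P ≀ A₅ = P⁵ : A₅` for the natural action of `A₅` on 5 points.

With permutations composed from left to right and points written `i ^ π`, as usual in permutation
group theory, the rule of multiplication is `(t π) (s σ) = (i ↦ t i * s (i ^ π)) (π σ)`.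
Mathlib composes from right to left, so the element written `t π` there is `⟨t, π⁻¹⟩` here. -/
abbrev Wreath : Type u := (Fin 5 → P) ⋊[permAction P] alternatingGroup (Fin 5)

variable {P}

/-- The element `t π` of the wreath product in the left-to-right convention. -/
def wr (t : Fin 5 → P) (π : alternatingGroup (Fin 5)) : Wreath P := ⟨t, π⁻¹⟩

theorem wr_mul_wr (t s : Fin 5 → P) (π σ : alternatingGroup (Fin 5)) :
    wr t π * wr s σ = wr (fun i => t i * s ((π : Equiv.Perm (Fin 5)) i)) (σ * π) := by
  ext i
  · rfl
  · simp [wr]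

/-- `(1 2 3)`; the points `1, …, 5` are `0, …, 4` here. -/
def c123 : alternatingGroup (Fin 5) := ⟨c[0, 1, 2], Equiv.Perm.mem_alternatingGroup.mpr (by decide)⟩

/-- `(1 2)(4 5)`. -/
def c12c45 : alternatingGroup (Fin 5) := ⟨c[0, 1] * c[3, 4], Equiv.Perm.mem_alternatingGroup.mpr (by decide)⟩

/-- `(1 4)(2 5)`. -/
def c14c25 : alternatingGroup (Fin 5) := ⟨c[0, 3] * c[1, 4], Equiv.Perm.mem_alternatingGroup.mpr (by decide)⟩

/-- `h₁ = (1, 1, 1, l, l⁻¹)(1 2 3)`. -/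
def h₁ (l : P) : Wreath P := wr ![1, 1, 1, l, l⁻¹] c123

/-- `h₂ = (m, m, m, 1, 1)(1 2)(4 5)`. -/
def h₂ (m : P) : Wreath P := wr ![m, m, m, 1, 1] c12c45

/-- `g = (1, m, 1, 1, m)(1 4)(2 5)`. -/
def gElt (m : P) : Wreath P := wr ![1, m, 1, 1, m] c14c25

/-- `H = ⟨h₁, h₂⟩`. -/
def HSub (m l : P) : Subgroup (Wreath P) := Subgroup.closure {h₁ l, h₂ m}

theorem gElt_mul_self {m : P} (hm : orderOf m = 2) : gElt m * gElt m = 1 := by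
  have hm2 : m * m = 1 := by rw [← pow_two, ← hm, pow_orderOf_eq_one]
  have hp : c14c25 * c14c25 = 1 := by decide
  rw [gElt, wr_mul_wr, hp]
  ext i
  · fin_cases i
    · exact one_mul 1
    · exact hm2
    · exact one_mul 1
    · exact one_mul 1
    · exact hm2
  · simp [wr]

theorem gElt_inv_mem {m : P} (hm : orderOf m = 2) (l : P) :
    (gElt m)⁻¹ ∈ DoubleCoset.doubleCoset (gElt m) (HSub m l : Set (Wreath P)) (HSub m l) := by
  rw [inv_eq_of_mul_eq_one_left (gElt_mul_self hm)]
  exact DoubleCoset.mem_doubleCoset_self _ _ _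

theorem gElt_notMem (m l : P) : gElt m ∉ HSub m l := by
  intro hmem
  have hle : HSub m l ≤ (MulAction.stabilizer (alternatingGroup (Fin 5))
      ({3, 4} : Finset (Fin 5))).comap SemidirectProduct.rightHom := by
    rw [HSub, Subgroup.closure_le]
    rintro x (rfl | rfl)
    · change c123⁻¹ • ({3, 4} : Finset (Fin 5)) = {3, 4}
      decide
    · change c12c45⁻¹ • ({3, 4} : Finset (Fin 5)) = {3, 4}
      decide
  have h : c14c25⁻¹ • ({3, 4} : Finset (Fin 5)) = {3, 4} := hle hmem
  revert h
  decide

/-- The graph `Γ = Cos(G, H, HgH)` with `G = P ≀ A₅`. -/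
def coverGraph {m : P} (hm : orderOf m = 2) (l : P) : SimpleGraph (RightCosets (HSub m l)) :=
  cosetGraph (HSub m l) (gElt m) (gElt_inv_mem hm l) (gElt_notMem m l)

/-- The action of `G = P ≀ A₅` on `Γ` by right multiplication. -/
def coverAction {m : P} (hm : orderOf m = 2) (l : P) :
    Wreath P →* (coverGraph hm l ≃g coverGraph hm l) :=
  cosetAction (HSub m l) (gElt m) (gElt_inv_mem hm l) (gElt_notMem m l)

variable (P) in
/-- The base group `P⁵` of the wreath product. -/
def baseGroup : Subgroup (Wreath P) := (SemidirectProduct.inl : (Fin 5 → P) →* Wreath P).range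

end Construction

end PetersenCover

/-! The subgroup `H` is a copy of S₃: `h₂` inverts `h₁`, and projection to A₅ maps `H`
isomorphically onto the stabiliser of the pair `{3, 4}`. The involution `g` commutes with `h₂`, so
`HgH` is the union of the cosets `H g`, `H g h₁`, `H g h₁⁻¹`. Sending `H x` to the image of `{3, 4}`
under `x` gives the covering of the Petersen graph, with fibres the orbits of `P⁵`. Arcs are all
translates of one arc, whose two extensions to a 2-arc are exchanged by `h₂`. This is
2-arc-transitivity.

Connectedness means that `h₁`, `h₂`, `g` generate `G` (`eq_top_of_generators_mem`). If `K` is the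
intersection of the generated subgroup with `P⁵`, then `K` projects onto a coordinate, and explicit
words give elements of `K` vanishing on two complementary pairs of the other coordinates. As `P` is
perfect, commutators of such elements fill the whole coordinate subgroup.

A walk without backtracking is a product of turns `g h₁^{±1}`. Its coordinates are words in `m`,
`l`, `l⁻¹`, computed formally; that a product is not in `H` is detected by its permutation or by a
word that cannot vanish in a nontrivial perfect quotient of the modular group. Finitely many turn
sequences show that no such walk of length below 10 closes up, while `(g h₁ g h₁⁻¹)⁵ = 1` gives a
10-cycle. Hence the girth is 10.

The same computation shows that of the two 3-arcs extending a 2-arc, the zigzag one begins a closed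
walk of length 10 without backtracking and the other does not. An automorphism fixing a 2-arc
therefore fixes both extensions, and by connectedness it is trivial; so `Aut Γ = G`. Finally, a
Cayley structure would give a complement `R` of `H` in `G`. On the six cosets of `R`, `h₂` would act
as three transpositions, an odd permutation, whereas every homomorphism from `G` to an abelian group
kills `h₂`. -/

namespace PetersenCover

universe u v

/-! ### Relations that force a perfect group generated by `m` and `l` to be trivial -/

section PerfectGroups

variable {P : Type u} [Group P] {m l : P}

/-- Inverses are tested separately because `P` may be infinite: conjugation by `s` could send a
subgroup properly into itself. -/
theorem closure_normal_of_forall_conj_mem {S T : Set P} (hS : Subgroup.closure S = ⊤)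
    (h : ∀ s ∈ S, ∀ t ∈ T, s * t * s⁻¹ ∈ Subgroup.closure T)
    (h' : ∀ s ∈ S, ∀ t ∈ T, s⁻¹ * t * s ∈ Subgroup.closure T) :
    (Subgroup.closure T).Normal := by
  have key : ∀ s : P, (∀ t ∈ T, s * t * s⁻¹ ∈ Subgroup.closure T) →
      ∀ n ∈ Subgroup.closure T, s * n * s⁻¹ ∈ Subgroup.closure T := by
    intro s hs n hn
    have : Subgroup.closure T ≤ (Subgroup.closure T).comap (MulAut.conj s).toMonoidHom := by
      rw [Subgroup.closure_le]
      exact hs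
    exact this hn
  refine ⟨fun n hn x => ?_⟩
  have hx : x ∈ Subgroup.closure S := hS ▸ Subgroup.mem_top x
  induction hx using Subgroup.closure_induction'' generalizing n with
  | mem s hs => exact key s (h s hs) n hn
  | inv_mem s hs => exact key s⁻¹ (by simpa using h' s hs) n hn
  | one => simpa using hn
  | mul a b _ _ iha ihb =>
    have : a * b * n * (a * b)⁻¹ = a * (b * n * b⁻¹) * a⁻¹ := by group
    rw [this]
    exact iha _ (ihb _ hn)

theorem mul_comm_of_closure_pair (hgen : Subgroup.closure {m, l} = (⊤ : Subgroup P))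
    (h : m * l = l * m) (x y : P) : x * y = y * x := by
  have hx : x ∈ Subgroup.closure {m, l} := hgen ▸ Subgroup.mem_top x
  have hy : y ∈ Subgroup.closure {m, l} := hgen ▸ Subgroup.mem_top y
  have hc : ∀ a ∈ ({m, l} : Set P), ∀ b ∈ ({m, l} : Set P), a * b = b * a := by
    rintro a (rfl | rfl) b (rfl | rfl) <;> first | rfl | exact h | exact h.symm
  have := (Subgroup.closure_le_centralizer_centralizer _ hx)
  rw [Subgroup.mem_centralizer_iff] at this
  refine (this y ?_).symm
  have h2 : Subgroup.closure {m, l} ≤ Subgroup.centralizer ({m, l} : Set P) := by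
    rw [Subgroup.closure_le]
    exact fun a ha => Subgroup.mem_centralizer_iff.mpr fun b hb => hc b hb a ha
  exact h2 hy

theorem eq_one_of_commute (hgen : Subgroup.closure {m, l} = (⊤ : Subgroup P))
    (hperf : commutator P = ⊤) (h : m * l = l * m) (x : P) : x = 1 := by
  have hx : x ∈ commutator P := hperf ▸ Subgroup.mem_top x
  have : commutator P ≤ ⊥ := by
    rw [commutator_def, Subgroup.commutator_le]
    intro a _ b _
    rw [Subgroup.mem_bot, commutatorElement_eq_one_iff_mul_comm]
    exact mul_comm_of_closure_pair hgen h a b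
  exact Subgroup.mem_bot.mp (this hx)

theorem closure_map_mk (hgen : Subgroup.closure {m, l} = (⊤ : Subgroup P)) (N : Subgroup P)
    [N.Normal] : Subgroup.closure {(m : P ⧸ N), (l : P ⧸ N)} = ⊤ := by
  have := MonoidHom.map_closure (QuotientGroup.mk' N) {m, l}
  rw [hgen, Set.image_pair] at this
  rw [← Subgroup.map_top_of_surjective _ (QuotientGroup.mk'_surjective N)]
  exact this.symm

theorem commutator_quotient (hperf : commutator P = ⊤) (N : Subgroup P) [N.Normal] :
    commutator (P ⧸ N) = ⊤ := by
  have := Subgroup.map_commutator ⊤ ⊤ (QuotientGroup.mk' N)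
  rw [← commutator_def, hperf,
    Subgroup.map_top_of_surjective _ (QuotientGroup.mk'_surjective N)] at this
  exact this.symm

/-- The quotient by `N` is generated by two commuting elements, so it is abelian as well as perfect.
-/
theorem eq_top_of_mul_comm_mem (hgen : Subgroup.closure {m, l} = (⊤ : Subgroup P))
    (hperf : commutator P = ⊤) (N : Subgroup P) [N.Normal] (h : (l * m)⁻¹ * (m * l) ∈ N) :
    N = ⊤ := by
  rw [eq_top_iff]
  intro x _
  rw [← QuotientGroup.eq_one_iff]
  refine eq_one_of_commute (closure_map_mk hgen N) (commutator_quotient hperf N) ?_ _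
  rw [← QuotientGroup.mk_mul, ← QuotientGroup.mk_mul]
  exact (QuotientGroup.eq.mpr h).symm

section Relations

variable (hgen : Subgroup.closure {m, l} = (⊤ : Subgroup P)) (hperf : commutator P = ⊤)
  (hm : m * m = 1) (hl : l * l * l = 1)

theorem mul_self_assoc (hm : m * m = 1) (x : P) : m * (m * x) = x := by
  rw [← mul_assoc, hm, one_mul]

theorem inv_eq_self (hm : m * m = 1) : m⁻¹ = m := inv_eq_of_mul_eq_one_left hm

theorem mul_self_eq_inv (hl : l * l * l = 1) : l * l = l⁻¹ := eq_inv_of_mul_eq_one_left hl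

theorem mul_self_eq_inv_assoc (hl : l * l * l = 1) (x : P) : l * (l * x) = l⁻¹ * x := by
  rw [← mul_assoc, mul_self_eq_inv hl]

theorem inv_mul_self_inv (hl : l * l * l = 1) : l⁻¹ * l⁻¹ = l := by
  rw [← mul_inv_rev, mul_self_eq_inv hl, inv_inv]

theorem inv_mul_self_inv_assoc (hl : l * l * l = 1) (x : P) : l⁻¹ * (l⁻¹ * x) = l * x := by
  rw [← mul_assoc, inv_mul_self_inv hl]

include hgen hperf hm in
/-- If `(l m)²` and `(m l)²` agree then `(l m)²` is central, and the central quotient is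
soluble. -/
theorem eq_one_of_sq_mul_comm (h : l⁻¹ * m * l⁻¹ * m * l * m * l * m = 1) (x : P) : x = 1 := by
  have mi := inv_eq_self hm
  set z := l * m * l * m with hz
  have hz' : z = m * l * m * l := by
    have : l⁻¹ * m * l⁻¹ * m * z = 1 := by rw [← h, hz]; group
    rw [eq_comm, ← inv_eq_of_mul_eq_one_right this]
    simp [mul_assoc, mi]
  have hzm : z * m = m * z := by
    conv_lhs => rw [hz']
    rw [hz]; group
  have hzl : z * l = l * z := by
    conv_rhs => rw [hz']
    rw [hz]; group
  -- Since `m l m = l⁻¹ z` with `z` central, `⟨l, z⟩` is normal. It is also abelian and contains the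
  -- commutator of `m` and `l`, so it is all of `P`.
  have hNn : (Subgroup.closure {l, z}).Normal := by
    have hlN : l ∈ Subgroup.closure {l, z} := Subgroup.subset_closure (by simp)
    have hzN : z ∈ Subgroup.closure {l, z} := Subgroup.subset_closure (by simp)
    have hmlm : m * l * m = l⁻¹ * z := by rw [hz]; group
    refine closure_normal_of_forall_conj_mem hgen ?_ ?_
    · rintro s (rfl | rfl) t (rfl | rfl)
      · rw [mi, hmlm]; exact mul_mem (inv_mem hlN) hzN
      · rw [← hzm]; simpa using hzN
      · simpa using hlN
      · rw [← hzl]; simpa using hzN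
    · rintro s (rfl | rfl) t (rfl | rfl)
      · rw [mi, hmlm]; exact mul_mem (inv_mem hlN) hzN
      · rw [mul_assoc, hzm]; simpa using hzN
      · simpa using hlN
      · rw [mul_assoc, hzl]; simpa using hzN
  have hN : Subgroup.closure {l, z} = ⊤ := by
    refine eq_top_of_mul_comm_mem hgen hperf _ ?_
    have hlN : l ∈ Subgroup.closure {l, z} := Subgroup.subset_closure (by simp)
    have := hNn.conj_mem _ (inv_mem hlN) m
    have := mul_mem this hlN
    rw [mi] at this
    simpa [mul_assoc, mi] using this
  exact eq_one_of_commute hN hperf hzl.symm x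

include hgen hperf hm in
theorem eq_top_of_sq_mul_comm_mem (N : Subgroup P) [N.Normal]
    (h : l⁻¹ * m * l⁻¹ * m * l * m * l * m ∈ N) : N = ⊤ := by
  rw [eq_top_iff]
  intro x _
  rw [← QuotientGroup.eq_one_iff]
  refine eq_one_of_sq_mul_comm (closure_map_mk hgen N) (commutator_quotient hperf N) ?_ ?_ _
  · rw [← QuotientGroup.mk_mul, hm, QuotientGroup.mk_one]
  · exact (QuotientGroup.eq_one_iff _).mpr h

include hgen hperf hm hl in
/-- If the commutator of `m` and `l` squares to `1` then the derived subgroup is abelian. -/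
theorem eq_one_of_commutator_sq (h : l⁻¹ * m * l * m * l⁻¹ * m * l * m = 1) (x : P) : x = 1 := by
  have mi := inv_eq_self hm
  have ma := mul_self_assoc hm
  have la := mul_self_eq_inv_assoc hl
  have li := inv_mul_self_inv hl
  set a := l * m * l⁻¹ * m with ha
  set b := m * l⁻¹ * m * l with hb
  have hbb : b * b = 1 := by
    have : b * b = m * (l⁻¹ * m * l * m * l⁻¹ * m * l * m) * m⁻¹ := by rw [hb]; group
    rw [this, h]; group
  have haa : a * a = 1 := by
    have : a * a = l * (b * b) * l⁻¹ := by rw [ha, hb]; group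
    rw [this, hbb]; group
  have hai : a⁻¹ = a := inv_eq_self haa
  have hbi : b⁻¹ = b := inv_eq_self hbb
  have hlbl : l * b * l⁻¹ = a := by rw [ha, hb]; group
  have hmam : m * a * m = a := by
    conv_rhs => rw [← hai]
    simp [ha, mul_assoc, mi, hm]
  have hmbm : m * b * m = b := by
    conv_rhs => rw [← hbi]
    simp [hb, mul_assoc, mi, ma]
  -- Both `l a l⁻¹` and `m (b a) m` equal `l⁻¹ m l⁻¹ m l⁻¹`; this uses `l³ = 1`.
  have hlal : l * a * l⁻¹ = b * a := by
    have : l * a * l⁻¹ = m * (b * a) * m := by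
      simp [ha, hb, mul_assoc, hm, ma, la]
    have h2 : m * (b * a) * m = (m * b * m) * (m * a * m) := by
      simp [mul_assoc, ma]
    rw [this, h2, hmam, hmbm]
  have hla' : l⁻¹ * a * l = b := by rw [← hlbl]; group
  have hlb' : l⁻¹ * b * l = b * a := by
    rw [← hlal, ← hlbl, ← li]
    simp [mul_assoc, la, li]
  -- The product `b a` is conjugate to `a`, so it squares to 1. Thus `⟨a, b⟩` is elementary abelian,
  -- permuted by `l` as `b ↦ a ↦ b a` and centralised by `m`.
  have hcomm : a * b = b * a := by
    have h1 : (b * a) * (b * a) = 1 := by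
      rw [← hlal]
      have : l * a * l⁻¹ * (l * a * l⁻¹) = l * (a * a) * l⁻¹ := by group
      rw [this, haa]; group
    rw [← inv_eq_self h1, mul_inv_rev, hai, hbi]
  have haN : a ∈ Subgroup.closure {a, b} := Subgroup.subset_closure (by simp)
  have hbN : b ∈ Subgroup.closure {a, b} := Subgroup.subset_closure (by simp)
  have hNn : (Subgroup.closure {a, b}).Normal := by
    refine closure_normal_of_forall_conj_mem hgen ?_ ?_
    · rintro s (rfl | rfl) t (rfl | rfl)
      · rw [mi, hmam]; exact haN
      · rw [mi, hmbm]; exact hbN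
      · rw [hlal]; exact mul_mem hbN haN
      · rw [hlbl]; exact haN
    · rintro s (rfl | rfl) t (rfl | rfl)
      · rw [mi, hmam]; exact haN
      · rw [mi, hmbm]; exact hbN
      · rw [hla']; exact hbN
      · rw [hlb']; exact mul_mem hbN haN
  have hN : Subgroup.closure {a, b} = ⊤ := by
    refine eq_top_of_mul_comm_mem hgen hperf _ ?_
    have e : (l * m)⁻¹ * (m * l) = b := by rw [hb, mul_inv_rev, mi]; group
    rwa [e]
  exact eq_one_of_commute hN hperf hcomm x

end Relations

end PerfectGroups

/-! ### Formal words in the modular group -/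

section Words

inductive Letter
  | m | l | l'
  deriving DecidableEq

/-- Prepend a letter to a word in `m`, `l`, `l'`, cancelling by `m² = l³ = 1`. -/
def Letter.push : Letter → List Letter → List Letter
  | .m, .m :: w => w
  | .l, .l :: w => .l' :: w
  | .l, .l' :: w => w
  | .l', .l :: w => w
  | .l', .l' :: w => .l :: w
  | a, w => a :: w

variable {P : Type u} [Group P]

def Letter.eval (m l : P) : Letter → P
  | .m => m
  | .l => l
  | .l' => l⁻¹

def evalWord (m l : P) (w : List Letter) : P := (w.map (Letter.eval m l)).prod

variable {m l : P}

@[simp] theorem evalWord_nil : evalWord m l [] = 1 := rfl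

@[simp] theorem evalWord_cons (a : Letter) (w : List Letter) :
    evalWord m l (a :: w) = a.eval m l * evalWord m l w := rfl

@[simp] theorem evalWord_append (v w : List Letter) :
    evalWord m l (v ++ w) = evalWord m l v * evalWord m l w := by
  simp [evalWord]

theorem evalWord_push (hm : m * m = 1) (hl : l * l * l = 1) (a : Letter) (w : List Letter) :
    evalWord m l (a.push w) = a.eval m l * evalWord m l w := by
  have ma := mul_self_assoc hm
  have la := mul_self_eq_inv_assoc hl
  have lia := inv_mul_self_inv_assoc hl
  rcases a <;> rcases w with _ | ⟨_ | _ | _, w⟩ <;>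
    simp [Letter.push, Letter.eval, ma, la, lia]

def reduceWord (w : List Letter) : List Letter := w.foldr Letter.push []

theorem evalWord_reduceWord (hm : m * m = 1) (hl : l * l * l = 1) (w : List Letter) :
    evalWord m l (reduceWord w) = evalWord m l w := by
  induction w with
  | nil => rfl
  | cons a w ih => rw [evalWord_cons, ← ih, ← evalWord_push hm hl]; rfl

/-- Words that are trivial in no nontrivial perfect quotient of the modular group `⟨m, l⟩`. -/
def essentialWords : List (List Letter) :=
  [[.m], [.l', .m, .l, .m], [.l', .m, .l, .m, .l', .m, .l, .m],
    [.l', .m, .l', .m, .l, .m, .l, .m]]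

/-- Some cyclic rotation of the word reduces to an essential word. -/
def isEssential (w : List Letter) : Bool :=
  (List.range w.length).any fun k =>
    essentialWords.contains (reduceWord (w.drop k ++ w.take k))

/-- Rotating a word conjugates its value, and reduction preserves the value. -/
theorem evalWord_ne_one_of_isEssential (hm : m * m = 1) (hl : l * l * l = 1)
    (hess : ∀ w ∈ essentialWords, evalWord m l w ≠ 1) {w : List Letter} (hw : isEssential w) :
    evalWord m l w ≠ 1 := by
  intro h1
  simp only [isEssential, List.any_eq_true, List.contains_iff_mem] at hw
  obtain ⟨k, -, hk⟩ := hw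
  refine hess _ hk ?_
  rw [evalWord_reduceWord hm hl, evalWord_append]
  have : evalWord m l (w.take k) * evalWord m l (w.drop k) = 1 := by
    rw [← evalWord_append, List.take_append_drop, h1]
  rw [mul_eq_one_iff_eq_inv.mp this, mul_inv_cancel]

theorem evalWord_ne_one_of_mem_essentialWords (hgen : Subgroup.closure {m, l} = (⊤ : Subgroup P))
    (hperf : commutator P = ⊤) (hm : m * m = 1) (hl : l * l * l = 1) (hm1 : m ≠ 1) :
    ∀ w ∈ essentialWords, evalWord m l w ≠ 1 := by
  intro w hw h
  simp only [essentialWords, List.mem_cons, List.not_mem_nil, or_false] at hw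
  rcases hw with rfl | rfl | rfl | rfl <;> simp only [evalWord_cons, evalWord_nil, Letter.eval,
    mul_one, ← mul_assoc] at h
  · exact hm1 h
  -- A trivial commutator has trivial square.
  · exact hm1 (eq_one_of_commutator_sq hgen hperf hm hl (by simp [h]) m)
  · exact hm1 (eq_one_of_commutator_sq hgen hperf hm hl h m)
  · exact hm1 (eq_one_of_sq_mul_comm hgen hperf hm h m)

end Words

/-! ### Formal computation in the wreath product -/

section Generators

/-- Names for the generators `g`, `h₁`, `h₁⁻¹`, `h₂` of the wreath product. -/
inductive Gen
  | g | a | a' | b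

variable {P : Type u} [Group P]

def Gen.elt (m l : P) : Gen → Wreath P
  | .g => gElt m
  | .a => h₁ l
  | .a' => (h₁ l)⁻¹
  | .b => h₂ m

def genProd (m l : P) (L : List Gen) : Wreath P := (L.map (Gen.elt m l)).prod

/-- The element `t π` of the wreath product, recorded as the list of pairs `(t i, i ^ π)`. -/
abbrev State := Fin 5 → List Letter × Fin 5

def Letter.pushEntry (a : Letter) (e : List Letter × Fin 5) : List Letter × Fin 5 :=
  (a.push e.1, e.2)

/-- Left multiplication by a generator. -/
def Gen.act : Gen → State → State
  | .g, s => ![s 3, Letter.m.pushEntry (s 4), s 2, s 0, Letter.m.pushEntry (s 1)]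
  | .a, s => ![s 1, s 2, s 0, Letter.l.pushEntry (s 3), Letter.l'.pushEntry (s 4)]
  | .a', s => ![s 2, s 0, s 1, Letter.l'.pushEntry (s 3), Letter.l.pushEntry (s 4)]
  | .b, s => ![Letter.m.pushEntry (s 1), Letter.m.pushEntry (s 0), Letter.m.pushEntry (s 2),
      s 4, s 3]

def State.one : State := fun i => ([], i)

def stateOf (L : List Gen) : State := L.foldr Gen.act State.one

/-- The state `s` describes the element `x`. -/
def Represents (m l : P) (s : State) (x : Wreath P) : Prop :=
  ∀ i, x.left i = evalWord m l (s i).1 ∧ (x.right⁻¹ : alternatingGroup (Fin 5)).1 i = (s i).2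

variable {m l : P}

theorem represents_one : Represents m l State.one 1 := fun _ => ⟨rfl, rfl⟩

theorem wr_left_right (x : Wreath P) : wr x.left x.right⁻¹ = x := by
  ext <;> simp [wr]

theorem c123_apply (i : Fin 5) : c123.1 i = ![1, 2, 0, 3, 4] i := by
  revert i; decide

theorem h₁_inv (l : P) : (h₁ l)⁻¹ = wr ![1, 1, 1, l⁻¹, l] c123⁻¹ := by
  rw [inv_eq_iff_mul_eq_one, h₁, wr_mul_wr]
  simp only [c123_apply]
  ext i
  · fin_cases i <;> simp [wr]
  · simp [wr]

/-- The table `p` replaces `π` by explicit values, so that each generator can be checked entry by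
entry. -/
theorem Represents.wr_mul {s s' : State} {x : Wreath P} (h : Represents m l s x)
    {t : Fin 5 → P} {π : alternatingGroup (Fin 5)} (p : Fin 5 → Fin 5) (hp : ∀ i, π.1 i = p i)
    (hs : ∀ i, evalWord m l (s' i).1 = t i * evalWord m l (s (p i)).1 ∧ (s' i).2 = (s (p i)).2) :
    Represents m l s' (wr t π * x) := by
  intro i
  rw [(hs i).1, (hs i).2, ← hp i, ← wr_left_right x, wr_mul_wr]
  refine ⟨?_, ?_⟩
  · rw [← (h _).1]; rfl
  · rw [← (h _).2]; simp [wr]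

theorem Represents.act (hm : m * m = 1) (hl : l * l * l = 1) {s : State} {x : Wreath P}
    (h : Represents m l s x) (γ : Gen) : Represents m l (γ.act s) (γ.elt m l * x) := by
  have e : ∀ (a : Letter) (w : List Letter),
      evalWord m l (a.push w) = a.eval m l * evalWord m l w := evalWord_push hm hl
  cases γ
  · refine h.wr_mul ![3, 4, 2, 0, 1] (by decide) fun i => ?_
    fin_cases i <;> simp [Gen.act, Letter.pushEntry, e, Letter.eval]
  · refine h.wr_mul ![1, 2, 0, 3, 4] (by decide) fun i => ?_
    fin_cases i <;> simp [Gen.act, Letter.pushEntry, e, Letter.eval]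
  · rw [Gen.elt, h₁_inv]
    refine h.wr_mul ![2, 0, 1, 3, 4] (by decide) fun i => ?_
    fin_cases i <;> simp [Gen.act, Letter.pushEntry, e, Letter.eval]
  · refine h.wr_mul ![1, 0, 2, 4, 3] (by decide) fun i => ?_
    fin_cases i <;> simp [Gen.act, Letter.pushEntry, e, Letter.eval]

theorem represents_stateOf (hm : m * m = 1) (hl : l * l * l = 1) (L : List Gen) :
    Represents m l (stateOf L) (genProd m l L) := by
  induction L with
  | nil => exact represents_one
  | cons γ L ih => exact ih.act hm hl γ

theorem Represents.eq_one {x : Wreath P} (h : Represents m l State.one x) : x = 1 := by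
  ext i
  · exact (h i).1
  · have : x.right⁻¹ = 1 := by
      ext i
      exact congrArg Fin.val (h i).2
    rw [inv_eq_one.mp this]
    rfl

/-- Relations that already follow from `m² = l³ = 1` become decidable statements about lists of
letters. -/
theorem genProd_eq_one (hm : m * m = 1) (hl : l * l * l = 1) (L : List Gen)
    (hL : ∀ i, stateOf L i = ([], i)) : genProd m l L = 1 := by
  have h := represents_stateOf hm hl L
  rw [show stateOf L = State.one from funext hL] at h
  exact h.eq_one

/-- The word lies in the base group, with the given entries. -/
theorem genProd_eq_inl (hm : m * m = 1) (hl : l * l * l = 1) (L : List Gen)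
    (hL : ∀ i, (stateOf L i).2 = i) :
    genProd m l L = SemidirectProduct.inl fun i => evalWord m l (stateOf L i).1 := by
  have h := represents_stateOf hm hl L
  ext i
  · exact (h i).1
  · have : (genProd m l L).right⁻¹ = 1 := by
      ext i
      exact congrArg Fin.val ((h i).2.trans (hL i))
    rw [inv_eq_one.mp this]
    rfl

section Relations

variable (hm : m * m = 1) (hl : l * l * l = 1)
include hm hl

theorem gElt_mul_gElt : gElt m * gElt m = 1 := by
  simpa [genProd, Gen.elt] using genProd_eq_one hm hl [.g, .g] (by decide)

theorem h₂_mul_h₂ : h₂ m * h₂ m = 1 := by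
  simpa [genProd, Gen.elt] using genProd_eq_one hm hl [.b, .b] (by decide)

theorem h₁_mul_h₁ : h₁ l * h₁ l = (h₁ l)⁻¹ := by
  rw [eq_inv_iff_mul_eq_one, mul_assoc]
  simpa [genProd, Gen.elt] using genProd_eq_one hm hl [.a, .a, .a] (by decide)

theorem h₁_mul_h₂ : h₁ l * h₂ m = h₂ m * (h₁ l)⁻¹ := by
  have h := genProd_eq_one hm hl [.a, .b, .a, .b] (by decide)
  simp only [genProd, List.map_cons, List.map_nil, Gen.elt, List.prod_cons, List.prod_nil,
    mul_one] at h
  have h' := eq_inv_of_mul_eq_one_left (mul_assoc (h₁ l) (h₂ m) _ ▸ h)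
  rw [h', mul_inv_rev, inv_eq_of_mul_eq_one_left (h₂_mul_h₂ hm hl)]

theorem gElt_mul_h₂ : gElt m * h₂ m = h₂ m * gElt m := by
  have h := genProd_eq_one hm hl [.g, .b, .g, .b] (by decide)
  simp only [genProd, List.map_cons, List.map_nil, Gen.elt, List.prod_cons, List.prod_nil,
    mul_one] at h
  have h' := eq_inv_of_mul_eq_one_left (mul_assoc (gElt m) (h₂ m) _ ▸ h)
  rw [h', mul_inv_rev, inv_eq_of_mul_eq_one_left (h₂_mul_h₂ hm hl),
    inv_eq_of_mul_eq_one_left (gElt_mul_gElt hm hl)]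

end Relations

end Generators

/-! ### Elements of `H` and products of turns -/

section Turns

variable {P : Type u} [Group P] {m l : P}

/-- The relations `h₁³ = h₂² = 1` and `h₁ h₂ = h₂ h₁⁻¹` bring each element to the form `h₂^j h₁^i`.
-/
theorem mem_HSub_iff (hm : m * m = 1) (hl : l * l * l = 1) {x : Wreath P} :
    x ∈ HSub m l ↔ ∃ y ∈ ({1, h₁ l, (h₁ l)⁻¹} : Set (Wreath P)), x = y ∨ x = h₂ m * y := by
  have ha : h₁ l ∈ HSub m l := Subgroup.subset_closure (by simp)
  have hb : h₂ m ∈ HSub m l := Subgroup.subset_closure (by simp)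
  have aa := h₁_mul_h₁ hm hl
  have ab := h₁_mul_h₂ hm hl
  have bb := h₂_mul_h₂ hm hl
  have bi := inv_eq_self bb
  have ab' : (h₁ l)⁻¹ * h₂ m = h₂ m * h₁ l := by
    rw [← mul_left_inj (h₂ m), mul_assoc, bb, mul_assoc, ab, ← mul_assoc, bb]; group
  constructor
  · intro hx
    have am : ∀ y ∈ ({1, h₁ l, (h₁ l)⁻¹} : Set (Wreath P)),
        h₁ l * y ∈ ({1, h₁ l, (h₁ l)⁻¹} : Set (Wreath P)) := by
      rintro y (rfl | rfl | rfl) <;> simp [aa]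
    have am' : ∀ y ∈ ({1, h₁ l, (h₁ l)⁻¹} : Set (Wreath P)),
        (h₁ l)⁻¹ * y ∈ ({1, h₁ l, (h₁ l)⁻¹} : Set (Wreath P)) := by
      rintro y (rfl | rfl | rfl) <;> simp [← mul_inv_rev, aa]
    induction hx using Subgroup.closure_induction_left with
    | one => exact ⟨1, by simp, Or.inl rfl⟩
    | mul_left z hz y _ ih =>
      obtain ⟨w, hw, h | h⟩ := ih <;> rw [h] <;> rcases hz with rfl | rfl
      · exact ⟨_, am w hw, Or.inl rfl⟩
      · exact ⟨w, hw, Or.inr rfl⟩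
      · exact ⟨_, am' w hw, Or.inr (by rw [← mul_assoc, ab, mul_assoc])⟩
      · exact ⟨w, hw, Or.inl (by rw [← mul_assoc, bb, one_mul])⟩
    | inv_mul_cancel z hz y _ ih =>
      obtain ⟨w, hw, h | h⟩ := ih <;> rw [h] <;> rcases hz with rfl | rfl
      · exact ⟨_, am' w hw, Or.inl rfl⟩
      · exact ⟨w, hw, Or.inr (by rw [bi])⟩
      · exact ⟨_, am w hw, Or.inr (by rw [← mul_assoc, ab', mul_assoc])⟩
      · exact ⟨w, hw, Or.inl (by rw [inv_mul_cancel_left])⟩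
  · rintro ⟨y, rfl | rfl | rfl, rfl | rfl⟩
    all_goals first
      | exact one_mem _
      | exact ha
      | exact inv_mem ha
      | exact mul_mem hb (one_mem _)
      | exact mul_mem hb ha
      | exact mul_mem hb (inv_mem ha)

/-- Some entry shows that the described element is not the identity. -/
def State.ne_one (s : State) : Bool :=
  -- The image of the point 4 need not be tested: a permutation fixing the other four points fixes
  -- it.
  (s 0).2 != 0 || (s 1).2 != 1 || (s 2).2 != 2 || (s 3).2 != 3 ||
    isEssential (s 0).1 || isEssential (s 1).1 || isEssential (s 2).1 || isEssential (s 3).1 ||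
    isEssential (s 4).1

/-- The six states describe `h x` for `h` in `H`, and `x` lies in `H` exactly when one of these
products is 1. -/
def State.notMem (s : State) : Bool :=
  s.ne_one && (Gen.a.act s).ne_one && (Gen.a'.act s).ne_one && (Gen.b.act s).ne_one &&
    (Gen.a.act (Gen.b.act s)).ne_one && (Gen.a'.act (Gen.b.act s)).ne_one

theorem ne_one_of_represents (hm : m * m = 1) (hl : l * l * l = 1)
    (hess : ∀ w ∈ essentialWords, evalWord m l w ≠ 1) {s : State} {x : Wreath P}
    (h : Represents m l s x) (hs : s.ne_one) : x ≠ 1 := by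
  rintro rfl
  have h1 : ∀ i, isEssential (s i).1 ≠ true := fun i hi =>
    evalWord_ne_one_of_isEssential hm hl hess hi (h i).1.symm
  have h2 : ∀ i, (s i).2 = i := fun i => (h i).2.symm
  simp [State.ne_one, h1, h2] at hs

theorem notMem_of_represents (hm : m * m = 1) (hl : l * l * l = 1)
    (hess : ∀ w ∈ essentialWords, evalWord m l w ≠ 1) {s : State} {x : Wreath P}
    (h : Represents m l s x) (hs : s.notMem) : x ∉ HSub m l := by
  rw [mem_HSub_iff hm hl]
  simp only [State.notMem, Bool.and_eq_true] at hs
  obtain ⟨⟨⟨⟨⟨h1, h2⟩, h3⟩, h4⟩, h5⟩, h6⟩ := hs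
  have n {s x} := @ne_one_of_represents P _ m l hm hl hess s x
  have hb := h.act hm hl .b
  rintro ⟨y, rfl | rfl | rfl, rfl | rfl⟩
  · exact n h h1 rfl
  · exact n hb h4 (by simp [Gen.elt, h₂_mul_h₂ hm hl])
  · exact n (h.act hm hl .a') h3 (by simp [Gen.elt])
  · exact n (hb.act hm hl .a') h6 (by simp [Gen.elt, mul_self_assoc (h₂_mul_h₂ hm hl)])
  · exact n (h.act hm hl .a) h2 (by simp [Gen.elt])
  · exact n (hb.act hm hl .a) h5 (by simp [Gen.elt, mul_self_assoc (h₂_mul_h₂ hm hl)])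

/-- One step of a walk that does not turn back: `H x` is followed by `H (turn b x)`. -/
def turn (m l : P) (b : Bool) : Wreath P := gElt m * cond b (h₁ l) (h₁ l)⁻¹

def turns (m l : P) (x : Wreath P) (ks : List Bool) : Wreath P :=
  ks.foldl (fun y b => turn m l b * y) x

@[simp] theorem turns_nil (x : Wreath P) : turns m l x [] = x := rfl

@[simp] theorem turns_cons (x : Wreath P) (b : Bool) (ks : List Bool) :
    turns m l x (b :: ks) = turns m l (turn m l b * x) ks := rfl

theorem turns_mul (x y : Wreath P) (ks : List Bool) :
    turns m l (x * y) ks = turns m l x ks * y := by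
  induction ks generalizing x with
  | nil => rfl
  | cons b ks ih => rw [turns_cons, ← mul_assoc, ih, turns_cons]

/-- No sequence of at most `n` turns leads from the state `s` into `H`. -/
def checkTurns : ℕ → State → Bool
  | 0, s => s.notMem
  | n + 1, s => s.notMem && checkTurns n (Gen.g.act (Gen.a.act s)) &&
      checkTurns n (Gen.g.act (Gen.a'.act s))

theorem turns_notMem (hm : m * m = 1) (hl : l * l * l = 1)
    (hess : ∀ w ∈ essentialWords, evalWord m l w ≠ 1) {n : ℕ} {s : State} {x : Wreath P}
    (h : Represents m l s x) (hs : checkTurns n s) {ks : List Bool} (hk : ks.length ≤ n) :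
    turns m l x ks ∉ HSub m l := by
  induction n generalizing s x ks with
  | zero =>
    rw [List.length_eq_zero_iff.mp (Nat.le_zero.mp hk)]
    exact notMem_of_represents hm hl hess h hs
  | succ n ih =>
    simp only [checkTurns, Bool.and_eq_true] at hs
    rcases ks with _ | ⟨b, ks⟩
    · exact notMem_of_represents hm hl hess h hs.1.1
    · have hk' : ks.length ≤ n := Nat.le_of_succ_le_succ hk
      rw [turns_cons]
      cases b
      · exact ih (by simpa [turn, mul_assoc, Gen.elt] using (h.act hm hl .a').act hm hl .g) hs.2 hk'
      · exact ih (by simpa [turn, mul_assoc, Gen.elt] using (h.act hm hl .a).act hm hl .g)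
          hs.1.2 hk'

set_option maxRecDepth 100000 in
-- One step along `g` followed by at most eight turns covers the closed walks of length 1 to 9.
theorem checkTurns_eight : checkTurns 8 (stateOf [.g]) = true := by decide +kernel

set_option maxRecDepth 100000 in
-- The state is that of the end of the 3-arc with two equal turns; seven more turns make a walk of
-- length 10.
theorem checkTurns_seven : checkTurns 7 (stateOf [.g, .a, .g, .a, .g]) = true := by
  decide +kernel

end Turns

/-! ### Subgroups of powers of a perfect group -/

section SubdirectProducts

variable {P : Type u} [Group P] {ι : Type v}

/-- The entries at `i` of the elements of `K` whose entries at all points of `S` are trivial. -/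
def entriesAt (K : Subgroup (ι → P)) (i : ι) (S : Set ι) : Subgroup P :=
  (K ⊓ Subgroup.pi S fun _ => ⊥).map (Pi.evalMonoidHom _ i)

variable {K : Subgroup (ι → P)} {i : ι} {S T : Set ι}

theorem mem_entriesAt {a : P} :
    a ∈ entriesAt K i S ↔ ∃ s ∈ K, (∀ j ∈ S, s j = 1) ∧ s i = a := by
  simp [entriesAt, Subgroup.mem_map, Subgroup.mem_pi, and_assoc]

theorem entriesAt_normal (h : entriesAt K i ∅ = ⊤) : (entriesAt K i S).Normal := by
  refine ⟨fun a ha b => ?_⟩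
  have hb : b ∈ entriesAt K i ∅ := h ▸ Subgroup.mem_top b
  rw [mem_entriesAt] at ha hb ⊢
  obtain ⟨s, hs, hsS, rfl⟩ := ha
  obtain ⟨t, ht, -, rfl⟩ := hb
  exact ⟨t * s * t⁻¹, K.mul_mem (K.mul_mem ht hs) (K.inv_mem ht),
    fun j hj => by simp [hsS j hj], rfl⟩

/-- If `s` is trivial on `S` and `t` on `T`, their commutator is trivial on both, and commutators
generate `P`. -/
theorem entriesAt_union (hperf : commutator P = ⊤) (hS : entriesAt K i S = ⊤)
    (hT : entriesAt K i T = ⊤) : entriesAt K i (S ∪ T) = ⊤ := by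
  rw [eq_top_iff, ← hperf, commutator_def, Subgroup.commutator_le]
  intro a _ b _
  have ha : a ∈ entriesAt K i S := hS ▸ Subgroup.mem_top a
  have hb : b ∈ entriesAt K i T := hT ▸ Subgroup.mem_top b
  rw [mem_entriesAt] at ha hb ⊢
  obtain ⟨s, hs, hsS, rfl⟩ := ha
  obtain ⟨t, ht, htT, rfl⟩ := hb
  refine ⟨s * t * s⁻¹ * t⁻¹, ?_, ?_, rfl⟩
  · exact K.mul_mem (K.mul_mem (K.mul_mem hs ht) (K.inv_mem hs)) (K.inv_mem ht)
  · rintro j (hj | hj)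
    · simp [hsS j hj]
    · simp [htT j hj]

theorem mulSingle_mem_of_entriesAt [DecidableEq ι] (h : entriesAt K i {i}ᶜ = ⊤) (a : P) :
    Pi.mulSingle i a ∈ K := by
  have ha : a ∈ entriesAt K i {i}ᶜ := h ▸ Subgroup.mem_top a
  rw [mem_entriesAt] at ha
  obtain ⟨s, hs, hsi, rfl⟩ := ha
  convert hs
  ext j
  by_cases hj : j = i
  · subst hj; simp
  · rw [Pi.mulSingle_eq_of_ne hj, hsi j hj]

end SubdirectProducts

/-! ### `h₁`, `h₂` and `g` generate the wreath product -/

section Generation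

/-- The products `w * c123 ^ y` represent the ten cosets of the stabiliser of `{3, 4}`, that is, the
Petersen vertices at distance 0, 1 and 2 from this pair. -/
theorem alternatingGroup_five_eq_mul (σ : alternatingGroup (Fin 5)) :
    ∃ i : Fin 3, ∃ j : Fin 2, ∃ y : Fin 3, ∃ w ∈ [1, c14c25, c14c25 * c123 * c14c25,
      c14c25 * c123⁻¹ * c14c25], σ = c123 ^ (i : ℕ) * c12c45 ^ (j : ℕ) * w * c123 ^ (y : ℕ) := by
  revert σ
  decide +kernel

theorem closure_perms :
    Subgroup.closure {c123, c12c45, c14c25} = (⊤ : Subgroup (alternatingGroup (Fin 5))) := by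
  rw [eq_top_iff]
  intro σ _
  have ha : c123 ∈ Subgroup.closure {c123, c12c45, c14c25} := Subgroup.subset_closure (by simp)
  have hb : c12c45 ∈ Subgroup.closure {c123, c12c45, c14c25} := Subgroup.subset_closure (by simp)
  have hg : c14c25 ∈ Subgroup.closure {c123, c12c45, c14c25} := Subgroup.subset_closure (by simp)
  obtain ⟨i, j, y, w, hw, rfl⟩ := alternatingGroup_five_eq_mul σ
  refine mul_mem (mul_mem (mul_mem (pow_mem ha _) (pow_mem hb _)) ?_) (pow_mem ha _)
  simp only [List.mem_cons, List.not_mem_nil, or_false] at hw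
  rcases hw with rfl | rfl | rfl | rfl
  · exact one_mem _
  · exact hg
  · exact mul_mem (mul_mem hg ha) hg
  · exact mul_mem (mul_mem hg (inv_mem ha)) hg

variable {P : Type u} [Group P] {m l : P}

theorem genProd_mem {X : Subgroup (Wreath P)} (ha : h₁ l ∈ X) (hb : h₂ m ∈ X) (hg : gElt m ∈ X)
    (L : List Gen) : genProd m l L ∈ X := by
  refine X.list_prod_mem fun x hx => ?_
  obtain ⟨γ, -, rfl⟩ := List.mem_map.mp hx
  cases γ
  exacts [hg, ha, inv_mem ha, hb]

theorem conj_mem_comap_inl {X : Subgroup (Wreath P)} {x : Wreath P} (hx : x ∈ X) {s : Fin 5 → P}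
    (hs : s ∈ X.comap SemidirectProduct.inl) :
    (fun i => x.left i * s (x.right.1⁻¹ i) * (x.left i)⁻¹) ∈
      X.comap SemidirectProduct.inl := by
  have h := mul_mem (mul_mem hx hs) (inv_mem hx)
  have e : x * SemidirectProduct.inl s = SemidirectProduct.inl
      (fun i => x.left i * s (x.right.1⁻¹ i) * (x.left i)⁻¹) * x := by
    ext i
    · change x.left i * s (x.right.1⁻¹ i) =
        x.left i * s (x.right.1⁻¹ i) * (x.left i)⁻¹ * x.left i
      rw [inv_mul_cancel_right]
    · simp
  rwa [e, mul_inv_cancel_right] at h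

theorem exists_right_eq {X : Subgroup (Wreath P)} (ha : h₁ l ∈ X) (hb : h₂ m ∈ X)
    (hg : gElt m ∈ X) (σ : alternatingGroup (Fin 5)) : ∃ x ∈ X, x.right = σ := by
  have h : Subgroup.closure {c123, c12c45, c14c25} ≤ X.map SemidirectProduct.rightHom := by
    rw [Subgroup.closure_le]
    rintro _ (rfl | rfl | rfl)
    · exact ⟨_, inv_mem ha, by simp [h₁, wr]⟩
    · exact ⟨_, inv_mem hb, by simp [h₂, wr]⟩
    · exact ⟨_, inv_mem hg, by simp [gElt, wr]⟩
  rw [closure_perms] at h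
  exact h (Subgroup.mem_top σ)

/-- The elements `h₁`, `h₂` and `g` generate the wreath product. -/
theorem eq_top_of_generators_mem (hgen : Subgroup.closure {m, l} = (⊤ : Subgroup P))
    (hperf : commutator P = ⊤) (hm : m * m = 1) (hl : l * l * l = 1) {X : Subgroup (Wreath P)}
    (ha : h₁ l ∈ X) (hb : h₂ m ∈ X) (hg : gElt m ∈ X) : X = ⊤ := by
  set K : Subgroup (Fin 5 → P) := X.comap SemidirectProduct.inl with hK
  have hmem (L : List Gen) (hL : ∀ i, (stateOf L i).2 = i) :
      (fun i => evalWord m l (stateOf L i).1) ∈ K := by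
    have := genProd_mem ha hb hg L
    rwa [genProd_eq_inl hm hl L hL] at this
  have hall : entriesAt K 3 ∅ = ⊤ := by
    -- The word lies in the base group and its entry at 3 is `m`. As `h₁` fixes the point 3 and has
    -- entry `l` there, the projection of `K` at 3 is also closed under conjugation by `l`.
    have hm3 : m ∈ entriesAt K 3 ∅ := mem_entriesAt.mpr
      ⟨_, hmem [.b, .a', .g, .a, .g, .a', .g, .a, .g, .a', .g] (by decide), by simp, by
        have : (stateOf [.b, .a', .g, .a, .g, .a', .g, .a, .g, .a', .g] 3).1 = [.m] := by decide
        simp only [this]; simp [Letter.eval]⟩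
    have hconj : ∀ s ∈ entriesAt K 3 ∅, l * s * l⁻¹ ∈ entriesAt K 3 ∅ := by
      intro s hs
      rw [mem_entriesAt] at hs ⊢
      obtain ⟨s, hs, -, rfl⟩ := hs
      refine ⟨_, conj_mem_comap_inl ha hs, by simp, ?_⟩
      have : (h₁ l).right.1⁻¹ 3 = 3 := by
        change c123⁻¹.1⁻¹ 3 = 3
        decide
      rw [this]; rfl
    have hconj' : ∀ s ∈ entriesAt K 3 ∅, l⁻¹ * s * l ∈ entriesAt K 3 ∅ := by
      intro s hs
      have := hconj _ (hconj _ hs)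
      have e : l * (l * s * l⁻¹) * l⁻¹ = (l * l) * s * (l * l)⁻¹ := by group
      rwa [e, mul_self_eq_inv hl, inv_inv] at this
    have hn : (entriesAt K 3 ∅).Normal := by
      rw [← Subgroup.closure_eq (entriesAt K 3 ∅)]
      refine closure_normal_of_forall_conj_mem hgen ?_ ?_ <;> rw [Subgroup.closure_eq]
      · rintro s (rfl | rfl) t ht
        · exact mul_mem (mul_mem hm3 ht) (inv_mem hm3)
        · exact hconj t ht
      · rintro s (rfl | rfl) t ht
        · exact mul_mem (mul_mem (inv_mem hm3) ht) hm3
        · exact hconj' t ht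
    refine eq_top_of_mul_comm_mem hgen hperf _ ?_
    have e : (l * m)⁻¹ * (m * l) = m⁻¹ * (l⁻¹ * m * l) := by group
    rw [e]
    exact mul_mem (inv_mem hm3) (hconj' _ hm3)
  -- A normal subgroup contains every rotation of its words; `k` is the rotation that turns `v` into
  -- the relator of `eq_top_of_sq_mul_comm_mem`.
  have htriv {S : Set (Fin 5)} (k : ℕ) (v : List Letter)
      (hv : v.drop k ++ v.take k = [.l', .m, .l', .m, .l, .m, .l, .m])
      (h : evalWord m l v ∈ entriesAt K 3 S) : entriesAt K 3 S = ⊤ := by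
    have hn := entriesAt_normal (S := S) hall
    refine eq_top_of_sq_mul_comm_mem hgen hperf hm _ ?_
    rw [← List.take_append_drop k v, evalWord_append] at h
    have h' := hn.mem_comm h
    rw [← evalWord_append, hv] at h'
    simpa [Letter.eval, mul_assoc] using h'
  have h12 : entriesAt K 3 {1, 2} = ⊤ := by
    refine htriv 2 [.l, .m, .l', .m, .l', .m, .l, .m] rfl (mem_entriesAt.mpr ⟨_, hmem [.a, .g, .a',
      .g, .a', .g, .a, .g, .a', .g, .a', .g, .a, .g, .a', .g, .a', .g] (by decide), ?_, ?_⟩)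
    · rintro j (rfl | rfl) <;> exact congrArg (evalWord m l) (by decide : _ = [])
    · exact congrArg (evalWord m l) (by decide)
  have h04 : entriesAt K 3 {0, 4} = ⊤ := by
    refine htriv 6 [.l', .m, .l, .m, .l, .m, .l', .m] rfl (mem_entriesAt.mpr ⟨_, hmem [.a', .g, .a,
      .g, .a', .g, .a', .g, .a, .g, .a', .g, .a', .g, .a, .g, .a', .g] (by decide), ?_, ?_⟩)
    · rintro j (rfl | rfl) <;> exact congrArg (evalWord m l) (by decide : _ = [])
    · exact congrArg (evalWord m l) (by decide)
  -- The pairs `{1, 2}` and `{0, 4}` together make up the complement of `{3}`.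
  have h3 (a : P) : Pi.mulSingle 3 a ∈ K := by
    refine mulSingle_mem_of_entriesAt ?_ a
    convert entriesAt_union hperf h12 h04
    ext i
    fin_cases i <;> simp
  have hsingle (i : Fin 5) (a : P) : Pi.mulSingle i a ∈ K := by
    obtain ⟨σ, hσ⟩ : ∃ σ : alternatingGroup (Fin 5), σ.1⁻¹ i = 3 := by
      revert i; decide +kernel
    obtain ⟨x, hx, rfl⟩ := exists_right_eq ha hb hg σ
    -- Conjugation by `x` moves coordinate 3 to `i` and conjugates the entry by `x.left i`, which is
    -- compensated in advance.
    have := conj_mem_comap_inl hx (h3 ((x.left i)⁻¹ * a * x.left i))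
    convert this using 1
    funext j
    by_cases hj : j = i
    · subst hj; rw [hσ]; simp [mul_assoc]
    · rw [Pi.mulSingle_eq_of_ne hj, Pi.mulSingle_eq_of_ne]
      · simp
      · rw [← hσ]; simpa using hj
  have hKtop : K = ⊤ := by
    rw [eq_top_iff]
    intro s _
    exact Subgroup.pi_mem_of_mulSingle_mem s fun i => hsingle i _
  rw [eq_top_iff]
  intro x _
  obtain ⟨y, hy, hyx⟩ := exists_right_eq ha hb hg x.right
  have : x = SemidirectProduct.inl (x.left * y.left⁻¹) * y := by
    ext <;> simp [hyx]
  rw [this]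
  exact mul_mem (show _ ∈ K from hKtop ▸ Subgroup.mem_top _) hy

end Generation

/-! ### Vertices of the cover and their images in the Petersen graph -/

section Vertices

variable {P : Type u} [Group P] {m l : P}

/-- The vertex `H x` of the cover. -/
def vertex (m l : P) (x : Wreath P) : RightCosets (HSub m l) := Quotient.mk _ x

theorem vertex_surjective (a : RightCosets (HSub m l)) : ∃ x, vertex m l x = a :=
  Quotient.exists_rep a

theorem vertex_eq_iff {x y : Wreath P} : vertex m l x = vertex m l y ↔ y * x⁻¹ ∈ HSub m l :=
  Quotient.eq.trans QuotientGroup.rightRel_apply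

theorem vertex_mul {h : Wreath P} (hh : h ∈ HSub m l) (x : Wreath P) :
    vertex m l (h * x) = vertex m l x := by
  rw [vertex_eq_iff, mul_inv_rev, mul_inv_cancel_left]
  exact inv_mem hh

theorem h₁_mem (m l : P) : h₁ l ∈ HSub m l := Subgroup.subset_closure (by simp)

theorem h₂_mem (m l : P) : h₂ m ∈ HSub m l := Subgroup.subset_closure (by simp)

theorem right_smul_of_mem {z : Wreath P} (hz : z ∈ HSub m l) :
    z.right • ({3, 4} : Finset (Fin 5)) = {3, 4} := by
  have hle : HSub m l ≤ (MulAction.stabilizer (alternatingGroup (Fin 5))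
      ({3, 4} : Finset (Fin 5))).comap SemidirectProduct.rightHom := by
    rw [HSub, Subgroup.closure_le]
    rintro x (rfl | rfl)
    · change c123⁻¹ • ({3, 4} : Finset (Fin 5)) = {3, 4}
      decide
    · change c12c45⁻¹ • ({3, 4} : Finset (Fin 5)) = {3, 4}
      decide
  exact hle hz

/-- The vertex of the Petersen graph below `H x`: the image of the pair `{4, 5}` under `x`. -/
def pairOf : RightCosets (HSub m l) → {s : Finset (Fin 5) // s.card = 2} :=
  Quotient.lift (fun x => ⟨x.right⁻¹ • {3, 4}, by rw [Finset.card_smul_finset]; rfl⟩) <| by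
    intro x y h
    have h' : y * x⁻¹ ∈ HSub m l := QuotientGroup.rightRel_apply.mp h
    have := right_smul_of_mem h'
    rw [SemidirectProduct.mul_right, SemidirectProduct.inv_right, mul_smul] at this
    rw [Subtype.mk.injEq, eq_inv_smul_iff, this]

theorem pairOf_vertex (x : Wreath P) : (pairOf (vertex m l x)).1 = x.right⁻¹ • {3, 4} := rfl

theorem pairOf_gElt_mul (x : Wreath P) :
    (pairOf (vertex m l (gElt m * x))).1 = x.right⁻¹ • {0, 1} := by
  rw [pairOf_vertex, SemidirectProduct.mul_right, mul_inv_rev, mul_smul]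
  exact congrArg _ (by decide : c14c25⁻¹⁻¹ • ({3, 4} : Finset (Fin 5)) = _)

theorem pairOf_turn_true_mul (x : Wreath P) :
    (pairOf (vertex m l (turn m l true * x))).1 = x.right⁻¹ • {1, 2} := by
  rw [pairOf_vertex, SemidirectProduct.mul_right, mul_inv_rev, mul_smul]
  exact congrArg _ (by decide : (c14c25⁻¹ * c123⁻¹)⁻¹ • ({3, 4} : Finset (Fin 5)) = _)

theorem pairOf_turn_false_mul (x : Wreath P) :
    (pairOf (vertex m l (turn m l false * x))).1 = x.right⁻¹ • {0, 2} := by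
  rw [pairOf_vertex, SemidirectProduct.mul_right, mul_inv_rev, mul_smul]
  exact congrArg _ (by decide : (c14c25⁻¹ * c123⁻¹⁻¹)⁻¹ • ({3, 4} : Finset (Fin 5)) = _)

theorem turn_true_ne_gElt (x : Wreath P) :
    vertex m l (turn m l true * x) ≠ vertex m l (gElt m * x) := by
  intro h
  have := congrArg (fun a => (pairOf a).1) h
  simp only [pairOf_turn_true_mul, pairOf_gElt_mul, smul_left_cancel_iff] at this
  revert this
  decide

theorem turn_false_ne_gElt (x : Wreath P) :
    vertex m l (turn m l false * x) ≠ vertex m l (gElt m * x) := by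
  intro h
  have := congrArg (fun a => (pairOf a).1) h
  simp only [pairOf_turn_false_mul, pairOf_gElt_mul, smul_left_cancel_iff] at this
  revert this
  decide

theorem turn_ne_gElt (b : Bool) (x : Wreath P) :
    vertex m l (turn m l b * x) ≠ vertex m l (gElt m * x) := by
  cases b
  exacts [turn_false_ne_gElt x, turn_true_ne_gElt x]

theorem turn_true_ne_turn_false (x : Wreath P) :
    vertex m l (turn m l true * x) ≠ vertex m l (turn m l false * x) := by
  intro h
  have := congrArg (fun a => (pairOf a).1) h
  simp only [pairOf_turn_true_mul, pairOf_turn_false_mul, smul_left_cancel_iff] at this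
  revert this
  decide

end Vertices

/-! ### Adjacency, 2-arc-transitivity, valency and connectedness -/

section Graph

variable {P : Type u} [Group P] {m l : P}

theorem mul_self_of_orderOf (hm : orderOf m = 2) : m * m = 1 := by
  rw [← pow_two, ← hm, pow_orderOf_eq_one]

theorem mul_self_mul_of_orderOf (hl : orderOf l = 3) : l * l * l = 1 := by
  rw [← pow_two, ← pow_succ]
  simpa only [hl] using pow_orderOf_eq_one l

theorem ne_one_of_orderOf (hm : orderOf m = 2) : m ≠ 1 := by
  rintro rfl
  simp at hm

variable (hm : orderOf m = 2) (hl : orderOf l = 3)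

theorem coverAction_vertex (z x : Wreath P) :
    coverAction hm l z (vertex m l x) = vertex m l (x * z⁻¹) := rfl

include hl in
-- As `g` commutes with `h₂`, a factor `h₂` to the right of `g` can be moved to the left and
-- absorbed in `H`.
theorem adj_vertex_iff (x : Wreath P) (b : RightCosets (HSub m l)) :
    (coverGraph hm l).Adj (vertex m l x) b ↔ b = vertex m l (gElt m * x) ∨
      b = vertex m l (turn m l true * x) ∨ b = vertex m l (turn m l false * x) := by
  have hm2 := mul_self_of_orderOf hm
  have hl3 := mul_self_mul_of_orderOf hl
  have ha := h₁_mem m l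
  obtain ⟨y, rfl⟩ := vertex_surjective b
  refine (cosetGraph_adj_mk _ _ _ _ x y).trans ?_
  rw [DoubleCoset.mem_doubleCoset]
  constructor
  · rintro ⟨a, ha', b, hb, hab⟩
    obtain ⟨z, hz, hz'⟩ := (mem_HSub_iff hm2 hl3).mp hb
    have hy : vertex m l y = vertex m l (gElt m * z * x) := by
      rcases hz' with rfl | rfl
      · rw [mul_assoc a, mul_inv_eq_iff_eq_mul, mul_assoc a] at hab
        rw [hab, vertex_mul ha']
      · rw [mul_assoc a, ← mul_assoc (gElt m), gElt_mul_h₂ hm2 hl3, mul_inv_eq_iff_eq_mul,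
          mul_assoc a, mul_assoc (h₂ m), mul_assoc (h₂ m)] at hab
        rw [hab, vertex_mul ha', vertex_mul (h₂_mem m l)]
    rw [hy]
    rcases hz with rfl | rfl | rfl
    · simp
    · exact Or.inr (Or.inl rfl)
    · exact Or.inr (Or.inr rfl)
  · have key : ∀ z ∈ HSub m l, vertex m l y = vertex m l (gElt m * z * x) →
        ∃ a ∈ (HSub m l : Set (Wreath P)), ∃ b ∈ (HSub m l : Set (Wreath P)),
          y * x⁻¹ = a * gElt m * b := by
      intro z hz h
      refine ⟨_, vertex_eq_iff.mp h.symm, z, hz, ?_⟩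
      group
    rintro (h | h | h)
    · exact key 1 (one_mem _) (by simpa using h)
    · exact key _ ha h
    · exact key _ (inv_mem ha) h

include hl in
theorem exists_arc {a b : RightCosets (HSub m l)} (h : (coverGraph hm l).Adj a b) :
    ∃ x, a = vertex m l x ∧ b = vertex m l (gElt m * x) := by
  obtain ⟨x, rfl⟩ := vertex_surjective a
  rcases (adj_vertex_iff hm hl x b).mp h with rfl | rfl | rfl
  · exact ⟨x, rfl, rfl⟩
  · refine ⟨h₁ l * x, (vertex_mul (h₁_mem m l) x).symm, ?_⟩
    rw [← mul_assoc]; rfl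
  · refine ⟨(h₁ l)⁻¹ * x, (vertex_mul (inv_mem (h₁_mem m l)) x).symm, ?_⟩
    rw [← mul_assoc]; rfl

include hm in
-- A representative `y` also encodes the vertex `H g y` from which `H y` was entered. Turns respect
-- this encoding because `g (g h₁^{±1} y) = h₁^{±1} y`.
theorem vertex_gElt_mul_turn (b : Bool) (y : Wreath P) :
    vertex m l (gElt m * (turn m l b * y)) = vertex m l y := by
  have hg : gElt m * gElt m = 1 := gElt_mul_self hm
  rw [turn, mul_assoc, ← mul_assoc (gElt m), hg, one_mul]
  cases b
  · exact vertex_mul (inv_mem (h₁_mem m l)) y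
  · exact vertex_mul (h₁_mem m l) y

include hl in
theorem exists_turn {c : RightCosets (HSub m l)} {y : Wreath P}
    (h : (coverGraph hm l).Adj (vertex m l y) c) (hc : vertex m l (gElt m * y) ≠ c) :
    ∃ b, c = vertex m l (turn m l b * y) := by
  rcases (adj_vertex_iff hm hl y c).mp h with rfl | rfl | rfl
  · exact absurd rfl hc
  · exact ⟨true, rfl⟩
  · exact ⟨false, rfl⟩

include hl in
/-- Every `2`-arc is the translate of a single one. -/
theorem exists_two_arc {a b c : RightCosets (HSub m l)} (hab : (coverGraph hm l).Adj a b)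
    (hbc : (coverGraph hm l).Adj b c) (hac : a ≠ c) :
    ∃ x, a = vertex m l x ∧ b = vertex m l (gElt m * x) ∧
      c = vertex m l (turn m l true * (gElt m * x)) := by
  have hm2 := mul_self_of_orderOf hm
  have hl3 := mul_self_mul_of_orderOf hl
  have hg : gElt m * gElt m = 1 := gElt_mul_self hm
  have hb := h₂_mem m l
  obtain ⟨x, rfl, rfl⟩ := exists_arc hm hl hab
  obtain ⟨_ | _, rfl⟩ := exists_turn hm hl hbc (by rwa [← mul_assoc, hg, one_mul])
  -- Replacing `x` by `h₂ x` keeps the arc, as `h₂` commutes with `g`, and exchanges the two turns,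
  -- as `h₂` inverts `h₁`.
  · refine ⟨h₂ m * x, (vertex_mul hb x).symm, ?_, ?_⟩
    · rw [← mul_assoc, gElt_mul_h₂ hm2 hl3, mul_assoc, vertex_mul hb]
    · have e : turn m l true * (gElt m * (h₂ m * x)) =
          h₂ m * (turn m l false * (gElt m * x)) := by
        simp only [turn, cond_true, cond_false]
        rw [← mul_assoc (gElt m) (h₂ m), gElt_mul_h₂ hm2 hl3, mul_assoc (h₂ m),
          mul_assoc (gElt m) (h₁ l), ← mul_assoc (h₁ l) (h₂ m), h₁_mul_h₂ hm2 hl3,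
          mul_assoc (h₂ m), ← mul_assoc (gElt m) (h₂ m), gElt_mul_h₂ hm2 hl3]
        simp only [mul_assoc]
      rw [e, vertex_mul hb]
  · exact ⟨x, rfl, rfl, rfl⟩

include hl in
theorem isSArcTransitive_two :
    IsSArcTransitive (coverGraph hm l) (coverAction hm l).range 2 := by
  intro a b ha hb
  obtain ⟨x, hx0, hx1, hx2⟩ := exists_two_arc hm hl (ha.1 0) (ha.1 1) (ha.2 0 2 rfl)
  obtain ⟨y, hy0, hy1, hy2⟩ := exists_two_arc hm hl (hb.1 0) (hb.1 1) (hb.2 0 2 rfl)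
  refine ⟨_, ⟨y⁻¹ * x, rfl⟩, ?_⟩
  have e : x * (y⁻¹ * x)⁻¹ = y := by group
  intro i
  fin_cases i
  · refine (congrArg _ hx0).trans (Eq.trans ?_ hy0.symm)
    rw [coverAction_vertex, e]
  · refine (congrArg _ hx1).trans (Eq.trans ?_ hy1.symm)
    rw [coverAction_vertex, mul_assoc, e]
  · refine (congrArg _ hx2).trans (Eq.trans ?_ hy2.symm)
    rw [coverAction_vertex, mul_assoc, mul_assoc, e]

include hl in
theorem ncard_neighborSet (a : RightCosets (HSub m l)) :
    ((coverGraph hm l).neighborSet a).ncard = 3 := by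
  obtain ⟨x, rfl⟩ := vertex_surjective a
  rw [Set.ncard_eq_three]
  refine ⟨vertex m l (gElt m * x), vertex m l (turn m l true * x),
    vertex m l (turn m l false * x), (turn_true_ne_gElt x).symm, (turn_false_ne_gElt x).symm,
    turn_true_ne_turn_false x, ?_⟩
  ext b
  exact adj_vertex_iff hm hl x b

include hl in
theorem coverGraph_connected (hgen : Subgroup.closure {m, l} = (⊤ : Subgroup P))
    (hperf : commutator P = ⊤) : (coverGraph hm l).Connected := by
  have htrans (x y z : Wreath P)
      (h : (coverGraph hm l).Reachable (vertex m l x) (vertex m l y)) :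
      (coverGraph hm l).Reachable (vertex m l (x * z)) (vertex m l (y * z)) := by
    have := h.map (coverAction hm l z⁻¹).toHom
    change (coverGraph hm l).Reachable (vertex m l (x * z⁻¹⁻¹)) (vertex m l (y * z⁻¹⁻¹)) at this
    rwa [inv_inv] at this
  -- The elements `z` with `H z` in the component of `H` form a subgroup, because right
  -- multiplication is an automorphism.
  let D : Subgroup (Wreath P) :=
    { carrier := {z | (coverGraph hm l).Reachable (vertex m l 1) (vertex m l z)}
      one_mem' := SimpleGraph.Reachable.refl _
      mul_mem' := fun {a b} ha hb => by
        have := htrans _ _ b ha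
        rw [one_mul] at this
        exact SimpleGraph.Reachable.trans hb this
      inv_mem' := fun {a} ha => by
        have := htrans _ _ a⁻¹ ha
        rw [one_mul, mul_inv_cancel] at this
        exact this.symm }
  have hH : HSub m l ≤ D := fun h hh => by
    change (coverGraph hm l).Reachable (vertex m l 1) (vertex m l h)
    rw [← mul_one h, vertex_mul hh]
  have hg : gElt m ∈ D := by
    refine SimpleGraph.Adj.reachable ?_
    rw [adj_vertex_iff hm hl, mul_one]
    exact Or.inl rfl
  have hD : D = ⊤ := eq_top_of_generators_mem hgen hperf (mul_self_of_orderOf hm)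
    (mul_self_mul_of_orderOf hl) (hH (h₁_mem m l)) (hH (h₂_mem m l)) hg
  have hreach (a : RightCosets (HSub m l)) : (coverGraph hm l).Reachable (vertex m l 1) a := by
    obtain ⟨x, rfl⟩ := vertex_surjective a
    exact (hD ▸ Subgroup.mem_top x : x ∈ D)
  have : Nonempty (RightCosets (HSub m l)) := ⟨vertex m l 1⟩
  exact ⟨fun a b => (hreach a).symm.trans (hreach b)⟩

end Graph

/-! ### The covering of the Petersen graph -/

section NormalCover

variable {P : Type u} [Group P] {m l : P} (hm : orderOf m = 2) (hl : orderOf l = 3)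

theorem disjoint_smul_finset (σ : alternatingGroup (Fin 5)) (s t : Finset (Fin 5)) :
    Disjoint (σ • s) (σ • t) ↔ Disjoint s t := by
  rw [← Finset.disjoint_coe, ← Finset.disjoint_coe, Finset.coe_smul_finset,
    Finset.coe_smul_finset, Set.disjoint_smul_set]

theorem eq_of_disjoint_of_card_eq_two (s : Finset (Fin 5)) (hs : s.card = 2)
    (h : Disjoint {3, 4} s) : s = {0, 1} ∨ s = {1, 2} ∨ s = {0, 2} := by
  revert s
  decide

theorem exists_smul_eq_of_card_eq_two (s : Finset (Fin 5)) (hs : s.card = 2) :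
    ∃ σ : alternatingGroup (Fin 5), σ • ({3, 4} : Finset (Fin 5)) = s := by
  revert s
  decide +kernel

theorem exists_mem_HSub_right_eq (m l : P) (σ : alternatingGroup (Fin 5))
    (hσ : σ • ({3, 4} : Finset (Fin 5)) = {3, 4}) : ∃ h ∈ HSub m l, h.right = σ := by
  have hw : σ ∈ [1, c123, c123⁻¹, c12c45, c12c45 * c123, c12c45 * c123⁻¹] := by
    revert σ
    decide +kernel
  have ha : c123 ∈ (HSub m l).map SemidirectProduct.rightHom :=
    ⟨_, inv_mem (h₁_mem m l), by simp [h₁, wr]⟩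
  have hb : c12c45 ∈ (HSub m l).map SemidirectProduct.rightHom :=
    ⟨_, inv_mem (h₂_mem m l), by simp [h₂, wr]⟩
  suffices σ ∈ (HSub m l).map SemidirectProduct.rightHom from this
  simp only [List.mem_cons, List.not_mem_nil, or_false] at hw
  rcases hw with rfl | rfl | rfl | rfl | rfl | rfl
  exacts [one_mem _, ha, inv_mem ha, hb, mul_mem hb ha, mul_mem hb (inv_mem ha)]

theorem pairOf_surjective : Function.Surjective (pairOf (m := m) (l := l)) := by
  rintro ⟨s, hs⟩
  obtain ⟨σ, rfl⟩ := exists_smul_eq_of_card_eq_two s hs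
  exact ⟨vertex m l (SemidirectProduct.inr σ⁻¹), Subtype.ext (by simp [pairOf_vertex])⟩

/-- Equal pairs differ by an element of the stabiliser of `{3, 4}`. Since `H` covers this
stabiliser, the representatives can be corrected to differ by an element of the base group. -/
theorem pairOf_vertex_eq_iff {x y : Wreath P} :
    pairOf (vertex m l x) = pairOf (vertex m l y) ↔
      ∃ n ∈ baseGroup P, vertex m l (x * n⁻¹) = vertex m l y := by
  rw [Subtype.ext_iff, pairOf_vertex, pairOf_vertex]
  constructor
  · intro h
    obtain ⟨z, hz, hzr⟩ := exists_mem_HSub_right_eq m l (y.right * x.right⁻¹)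
      (by rw [mul_smul, h, smul_inv_smul])
    refine ⟨y⁻¹ * z * x, ?_, ?_⟩
    · rw [baseGroup, SemidirectProduct.range_inl_eq_ker_rightHom, MonoidHom.mem_ker]
      simp [hzr]
    · have e : x * (y⁻¹ * z * x)⁻¹ = z⁻¹ * y := by group
      rw [e, vertex_mul (inv_mem hz)]
  · rintro ⟨n, ⟨t, rfl⟩, h⟩
    have := congrArg (fun a => (pairOf a).1) h
    simpa [pairOf_vertex] using this

include hl

theorem pairOf_disjoint {a b : RightCosets (HSub m l)} (h : (coverGraph hm l).Adj a b) :
    Disjoint (pairOf a).1 (pairOf b).1 := by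
  obtain ⟨x, rfl, rfl⟩ := exists_arc hm hl h
  rw [pairOf_gElt_mul, pairOf_vertex, disjoint_smul_finset]
  decide

theorem exists_adj_pairOf_eq (a : RightCosets (HSub m l)) (s : {s : Finset (Fin 5) // s.card = 2})
    (h : Disjoint (pairOf a).1 s.1) : ∃ b, (coverGraph hm l).Adj a b ∧ pairOf b = s := by
  obtain ⟨x, rfl⟩ := vertex_surjective a
  have h' : Disjoint {3, 4} (x.right • s.1) := by
    rw [pairOf_vertex] at h
    rwa [← disjoint_smul_finset x.right⁻¹, inv_smul_smul]
  simp only [adj_vertex_iff hm hl, Subtype.ext_iff]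
  rcases eq_of_disjoint_of_card_eq_two _ (by rw [Finset.card_smul_finset, s.2]) h' with e | e | e
    <;> rw [← eq_inv_smul_iff] at e
  · exact ⟨_, Or.inl rfl, by rw [pairOf_gElt_mul, e]⟩
  · exact ⟨_, Or.inr (Or.inl rfl), by rw [pairOf_turn_true_mul, e]⟩
  · exact ⟨_, Or.inr (Or.inr rfl), by rw [pairOf_turn_false_mul, e]⟩

theorem eq_of_adj_of_pairOf_eq {a b c : RightCosets (HSub m l)} (hb : (coverGraph hm l).Adj a b)
    (hc : (coverGraph hm l).Adj a c) (h : pairOf b = pairOf c) : b = c := by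
  obtain ⟨x, rfl⟩ := vertex_surjective a
  rw [adj_vertex_iff hm hl] at hb hc
  rw [Subtype.ext_iff] at h
  rcases hb with rfl | rfl | rfl <;> rcases hc with rfl | rfl | rfl <;>
    first
    | rfl
    | (simp only [pairOf_turn_true_mul, pairOf_gElt_mul, pairOf_turn_false_mul,
        smul_left_cancel_iff] at h
       exact absurd h (by decide))

omit hl in
theorem orbitRel_iff (a b : RightCosets (HSub m l)) :
    MulAction.orbitRel ((baseGroup P).map (coverAction hm l)) (RightCosets (HSub m l)) a b ↔
      pairOf a = pairOf b := by
  obtain ⟨x, rfl⟩ := vertex_surjective a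
  obtain ⟨y, rfl⟩ := vertex_surjective b
  rw [eq_comm, pairOf_vertex_eq_iff, MulAction.orbitRel_apply, MulAction.mem_orbit_iff]
  constructor
  · rintro ⟨⟨_, n, hn, rfl⟩, h⟩
    exact ⟨n, hn, h⟩
  · rintro ⟨n, hn, h⟩
    exact ⟨⟨_, n, hn, rfl⟩, h⟩

/-- The orbits of the base group are the vertices of the Petersen graph. -/
noncomputable def orbitEquiv :
    MulAction.orbitRel.Quotient ((baseGroup P).map (coverAction hm l)) (RightCosets (HSub m l)) ≃
      {s : Finset (Fin 5) // s.card = 2} :=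
  Equiv.ofBijective (Quotient.lift pairOf fun a b h => (orbitRel_iff hm a b).mp h) <| by
    constructor
    · rintro ⟨a⟩ ⟨b⟩ h
      exact Quotient.sound ((orbitRel_iff hm a b).mpr h)
    · intro s
      obtain ⟨a, ha⟩ := pairOf_surjective (m := m) (l := l) s
      exact ⟨Quotient.mk _ a, ha⟩

omit hl in
theorem orbitEquiv_mk (a : RightCosets (HSub m l)) :
    orbitEquiv hm (Quotient.mk _ a) = pairOf a := rfl

theorem normalQuotient_adj_iff (a b : RightCosets (HSub m l)) :
    (normalQuotient (coverGraph hm l) ((baseGroup P).map (coverAction hm l))).Adj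
      (Quotient.mk _ a) (Quotient.mk _ b) ↔ Disjoint (pairOf a).1 (pairOf b).1 := by
  constructor
  · rintro ⟨-, a', b', ha, hb, hab⟩
    rw [← orbitEquiv_mk hm, ← orbitEquiv_mk hm, ← ha, ← hb]
    exact pairOf_disjoint hm hl hab
  · intro h
    refine ⟨fun hab => ?_, ?_⟩
    · have hab' : pairOf a = pairOf b := congrArg (orbitEquiv hm) hab
      exact petersenGraph.loopless.irrefl _ (show petersenGraph.Adj (pairOf a) (pairOf a) from
        show Disjoint (pairOf a).1 (pairOf a).1 by rw [← hab'] at h; exact h)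
    · obtain ⟨c, hc, hcb⟩ := exists_adj_pairOf_eq hm hl a _ h
      exact ⟨a, c, rfl, (orbitEquiv hm).injective hcb, hc⟩

theorem isNormalCover_petersenGraph :
    IsNormalCover (coverGraph hm l) (coverAction hm l).range
      ((baseGroup P).map (coverAction hm l)) petersenGraph where
  le := Subgroup.map_le_range _ _
  normal := by
    have hN : (baseGroup P).Normal := by
      rw [baseGroup, SemidirectProduct.range_inl_eq_ker_rightHom]
      infer_instance
    refine ⟨?_⟩
    rintro ⟨_, z, rfl⟩ ⟨n, hn, hnz⟩ ⟨_, w, rfl⟩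
    refine ⟨w * n * w⁻¹, hN.conj_mem n hn w, ?_⟩
    rw [map_mul, map_mul, map_inv, hnz]
    rfl
  three_le_orbits := by
    rw [ENat.card_congr (orbitEquiv hm), ENat.card_eq_coe_fintype_card,
      show Fintype.card {s : Finset (Fin 5) // s.card = 2} = 10 by decide]
    norm_num
  quotient_iso := ⟨⟨orbitEquiv hm, by
    rintro ⟨a⟩ ⟨b⟩
    exact (normalQuotient_adj_iff hm hl a b).symm⟩⟩
  bijOn_neighborSet a := by
    refine ⟨fun b hb => ?_, fun b hb c hc h => ?_, ?_⟩
    · exact (normalQuotient_adj_iff hm hl a b).mpr (pairOf_disjoint hm hl hb)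
    · exact eq_of_adj_of_pairOf_eq hm hl hb hc (congrArg (orbitEquiv hm) h)
    · rintro ⟨b⟩ hb
      obtain ⟨c, hc, hcb⟩ :=
        exists_adj_pairOf_eq hm hl a _ ((normalQuotient_adj_iff hm hl a b).mp hb)
      exact ⟨c, hc, (orbitEquiv hm).injective hcb⟩

end NormalCover

/-! ### Walks without backtracking, decagons and the girth -/

section Walks

variable {P : Type u} [Group P] {m l : P} (hm : orderOf m = 2) (hl : orderOf l = 3)

include hl in
/-- A walk that never turns back is a sequence of turns. -/
theorem exists_turns (n : ℕ) (v : ℕ → RightCosets (HSub m l)) (y : Wreath P)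
    (h0 : v 0 = vertex m l (gElt m * y)) (h1 : v 1 = vertex m l y)
    (hadj : ∀ i < n, (coverGraph hm l).Adj (v (i + 1)) (v (i + 2)))
    (hne : ∀ i < n, v i ≠ v (i + 2)) :
    ∃ ks : List Bool, ks.length = n ∧ v (n + 1) = vertex m l (turns m l y ks) := by
  induction n generalizing v y with
  | zero => exact ⟨[], rfl, h1⟩
  | succ n ih =>
    obtain ⟨b, hb⟩ := exists_turn hm hl (y := y) (c := v 2) (h1 ▸ hadj 0 n.succ_pos)
      (h0 ▸ hne 0 n.succ_pos)
    obtain ⟨ks, hks, h⟩ := ih (fun i => v (i + 1)) (turn m l b * y)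
      (h1.trans (vertex_gElt_mul_turn hm b y).symm) hb
      (fun i hi => hadj (i + 1) (Nat.succ_lt_succ hi))
      (fun i hi => hne (i + 1) (Nat.succ_lt_succ hi))
    exact ⟨b :: ks, by rw [List.length_cons, hks], h⟩

variable (hgen : Subgroup.closure {m, l} = (⊤ : Subgroup P)) (hperf : commutator P = ⊤)

include hl hgen hperf in
/-- There are no closed walks of length less than `10` without backtracking. -/
theorem ne_of_nonbacktracking {n : ℕ} (hn : n ≠ 0) (hn' : n < 10)
    (v : ℕ → RightCosets (HSub m l)) (hadj : ∀ i < n, (coverGraph hm l).Adj (v i) (v (i + 1)))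
    (hne : ∀ i, i + 1 < n → v i ≠ v (i + 2)) : v n ≠ v 0 := by
  have hm2 := mul_self_of_orderOf hm
  have hl3 := mul_self_mul_of_orderOf hl
  have hg : gElt m * gElt m = 1 := gElt_mul_self hm
  have hess := evalWord_ne_one_of_mem_essentialWords hgen hperf hm2 hl3 (ne_one_of_orderOf hm)
  obtain ⟨n, rfl⟩ := Nat.exists_eq_succ_of_ne_zero hn
  obtain ⟨x, h0, h1⟩ := exists_arc hm hl (hadj 0 n.succ_pos)
  obtain ⟨ks, hks, h⟩ := exists_turns hm hl n v (gElt m * x)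
    (by rw [h0, ← mul_assoc, hg, one_mul]) h1 (fun i hi => hadj (i + 1) (Nat.succ_lt_succ hi))
    (fun i hi => hne i (Nat.succ_lt_succ hi))
  rw [Nat.succ_eq_add_one, h, h0, turns_mul]
  intro h'
  refine turns_notMem hm2 hl3 hess (represents_stateOf hm2 hl3 [.g]) checkTurns_eight
    (ks := ks) (by omega) ?_
  have := vertex_eq_iff.mp h'.symm
  simpa [mul_assoc, genProd, Gen.elt] using this

/-- The `3`-arc starts a closed walk of length `10` without backtracking. -/
def OnDecagon {V : Type u} (Γ : SimpleGraph V) (a b c d : V) : Prop :=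
  ∃ v : ℕ → V, v 0 = a ∧ v 1 = b ∧ v 2 = c ∧ v 3 = d ∧ v 10 = v 0 ∧
    (∀ i < 10, Γ.Adj (v i) (v (i + 1))) ∧ ∀ i < 9, v i ≠ v (i + 2)

theorem OnDecagon.map {V : Type u} {Γ : SimpleGraph V} {a b c d : V} (h : OnDecagon Γ a b c d)
    (f : Γ ≃g Γ) : OnDecagon Γ (f a) (f b) (f c) (f d) := by
  obtain ⟨v, rfl, rfl, rfl, rfl, h10, hadj, hne⟩ := h
  exact ⟨fun i => f (v i), rfl, rfl, rfl, rfl, congrArg f h10,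
    fun i hi => f.map_rel_iff.mpr (hadj i hi), fun i hi h => hne i hi (f.injective h)⟩

include hl hgen hperf in
-- The first three steps are prescribed and the other seven are turns, so `checkTurns_seven`
-- applies.
theorem not_onDecagon (x : Wreath P) :
    ¬ OnDecagon (coverGraph hm l) (vertex m l x) (vertex m l (gElt m * x))
      (vertex m l (turn m l true * (gElt m * x)))
      (vertex m l (turn m l true * (turn m l true * (gElt m * x)))) := by
  have hm2 := mul_self_of_orderOf hm
  have hl3 := mul_self_mul_of_orderOf hl
  have hess := evalWord_ne_one_of_mem_essentialWords hgen hperf hm2 hl3 (ne_one_of_orderOf hm)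
  rintro ⟨v, h0, -, h2, h3, h10, hadj, hne⟩
  obtain ⟨ks, hks, h⟩ := exists_turns hm hl 7 (fun i => v (i + 2))
    (turn m l true * (turn m l true * (gElt m * x)))
    (h2.trans (vertex_gElt_mul_turn hm _ _).symm) h3 (fun i hi => hadj (i + 3) (by omega))
    (fun i hi => hne (i + 2) (by omega))
  have h' : vertex m l x = vertex m l _ := h0.symm.trans (h10.symm.trans h)
  rw [← mul_assoc, ← mul_assoc, turns_mul, vertex_eq_iff, mul_inv_cancel_right] at h'
  refine turns_notMem hm2 hl3 hess (represents_stateOf hm2 hl3 [.g, .a, .g, .a, .g])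
    checkTurns_seven (ks := ks) hks.le ?_
  convert h' using 2
  simp [genProd, Gen.elt, turn, mul_assoc]

/-- The closed walk of length `10` with alternating turns. -/
def zigzag (m l : P) : ℕ → Wreath P
  | 0 => 1
  | n + 1 => turn m l (n.bodd) * zigzag m l n

theorem zigzag_ten (hm : m * m = 1) (hl : l * l * l = 1) : zigzag m l 10 = 1 := by
  have h := genProd_eq_one hm hl [.g, .a, .g, .a', .g, .a, .g, .a', .g, .a, .g, .a', .g, .a, .g,
    .a', .g, .a, .g, .a'] (by decide)
  simpa [zigzag, turn, genProd, Gen.elt, mul_assoc] using h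

include hl in
theorem adj_zigzag (i : ℕ) (x : Wreath P) :
    (coverGraph hm l).Adj (vertex m l (zigzag m l i * x))
      (vertex m l (zigzag m l (i + 1) * x)) := by
  rw [adj_vertex_iff hm hl, zigzag, mul_assoc]
  cases i.bodd <;> simp

include hm in
theorem zigzag_ne (i : ℕ) (x : Wreath P) :
    vertex m l (zigzag m l i * x) ≠ vertex m l (zigzag m l (i + 2) * x) := by
  rw [zigzag, mul_assoc, ← vertex_gElt_mul_turn hm i.bodd, ← mul_assoc (turn m l i.bodd)]
  exact (turn_ne_gElt _ _).symm

include hl in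
theorem onDecagon (x : Wreath P) :
    OnDecagon (coverGraph hm l) (vertex m l x) (vertex m l (gElt m * x))
      (vertex m l (turn m l true * (gElt m * x)))
      (vertex m l (turn m l false * (turn m l true * (gElt m * x)))) := by
  have hm2 := mul_self_of_orderOf hm
  have hl3 := mul_self_mul_of_orderOf hl
  have e : turn m l false * (h₁ l * x) = gElt m * x := by simp [turn, mul_assoc]
  -- The zigzag opens with the turn `g h₁⁻¹`; starting from `h₁ x`, which names the same vertex as
  -- `x`, cancels the `h₁⁻¹`.
  refine ⟨fun i => vertex m l (zigzag m l i * (h₁ l * x)), ?_, ?_, ?_, ?_, ?_,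
    fun i _ => adj_zigzag hm hl i _, fun i _ => zigzag_ne hm i _⟩
  · simp [zigzag, vertex_mul (h₁_mem m l)]
  · simp [zigzag, e]
  · simp [zigzag, mul_assoc, e]
  · simp [zigzag, mul_assoc, e]
  · simp only [zigzag_ten hm2 hl3]; rfl

include hl hgen hperf in
theorem egirth_coverGraph : (coverGraph hm l).egirth = 10 := by
  have hm2 := mul_self_of_orderOf hm
  have hl3 := mul_self_mul_of_orderOf hl
  apply le_antisymm
  · have hc : (SimpleGraph.cycleGraph 10).IsContained (coverGraph hm l) := by
      let v : ℕ → RightCosets (HSub m l) := fun i => vertex m l (zigzag m l i * 1)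
      have hlt : ∀ i j : Fin 10, i < j → v i ≠ v j := by
        intro i j hij h
        obtain ⟨k, hk⟩ := Nat.exists_eq_add_of_lt hij
        -- A repeated vertex would close a segment of length below 10; no backtracking condition is
        -- needed where the segment closes.
        refine ne_of_nonbacktracking hm hl hgen hperf (n := k + 1) k.succ_ne_zero (by omega)
          (fun n => v (i + n)) (fun n _ => adj_zigzag hm hl _ _) (fun n _ => zigzag_ne hm _ _) ?_
        have e : (i : ℕ) + (k + 1) = j := by omega
        change v (i + (k + 1)) = v i
        rw [e, h]
      have hinj : Function.Injective fun i : Fin 10 => v i := by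
        intro i j h
        rcases lt_trichotomy i j with hij | hij | hij
        · exact absurd h (hlt i j hij)
        · exact hij
        · exact absurd h.symm (hlt j i hij)
      have h0 : v 10 = v 0 := by simp only [v, zigzag_ten hm2 hl3]; rfl
      have hstep : ∀ i : Fin 10, (coverGraph hm l).Adj (v i) (v ((i + 1 : Fin 10) : ℕ)) := by
        intro i
        have := adj_zigzag hm hl (i : ℕ) 1
        by_cases hi : i = 9
        · subst hi
          change (coverGraph hm l).Adj (v 9) (v 0)
          rw [← h0]
          exact this
        · have : ((i + 1 : Fin 10) : ℕ) = i + 1 := by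
            clear this
            revert i; decide
          rw [this]; assumption
      refine ⟨⟨⟨fun i => v i, ?_⟩, hinj⟩⟩
      intro i j hij
      rw [SimpleGraph.cycleGraph_adj] at hij
      rcases hij with h | h
      · rw [sub_eq_iff_eq_add'.mp h]
        exact (hstep j).symm
      · rw [sub_eq_iff_eq_add'.mp h]
        exact hstep i
    obtain ⟨a, w, hw, hlen⟩ := (SimpleGraph.cycleGraph_isContained_iff (by norm_num)).mp hc
    have := SimpleGraph.egirth_le_length hw
    rwa [hlen] at this
  · rw [SimpleGraph.le_egirth]
    intro a w hw
    by_contra! hlt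
    have hlt' : w.length < 10 := by exact_mod_cast hlt
    have h3 := hw.three_le_length
    refine ne_of_nonbacktracking hm hl hgen hperf (n := w.length) (by omega) hlt' w.getVert
      (fun i hi => w.adj_getVert_succ hi) (fun i hi => ?_) (by simp)
    have := hw.getVert_sub_one_ne_getVert_add_one (i := i + 1) (by omega)
    simpa using this

end Walks

/-! ### The automorphism group -/

section Automorphisms

variable {P : Type u} [Group P] {m l : P} (hm : orderOf m = 2) (hl : orderOf l = 3)
  (hgen : Subgroup.closure {m, l} = (⊤ : Subgroup P)) (hperf : commutator P = ⊤)

include hl hgen hperf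

/-- An automorphism fixing a `2`-arc fixes the neighbours of its last vertex. -/
theorem fixes_of_fixes_two_arc (f : coverGraph hm l ≃g coverGraph hm l)
    {a b c d : RightCosets (HSub m l)} (hab : (coverGraph hm l).Adj a b)
    (hbc : (coverGraph hm l).Adj b c) (hac : a ≠ c) (hfa : f a = a) (hfb : f b = b)
    (hfc : f c = c) (hcd : (coverGraph hm l).Adj c d) : f d = d := by
  obtain ⟨x, rfl, rfl, rfl⟩ := exists_two_arc hm hl hab hbc hac
  set y := turn m l true * (gElt m * x) with hy
  have hgy : vertex m l (gElt m * y) = vertex m l (gElt m * x) := vertex_gElt_mul_turn hm _ _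
  have hnb {d} := adj_vertex_iff hm hl y d
  have hadj {d} (h : (coverGraph hm l).Adj (vertex m l y) d) :
      (coverGraph hm l).Adj (vertex m l y) (f d) := by
    rw [← hfc]
    exact f.map_rel_iff.mpr h
  have hfalse : f (vertex m l (turn m l false * y)) = vertex m l (turn m l false * y) := by
    rcases hnb.mp (hadj (hnb.mpr (Or.inr (Or.inr rfl)))) with h | h | h
    · rw [hgy, ← hfb] at h
      have := f.injective h
      rw [← hgy] at this
      exact absurd this (turn_ne_gElt _ _)
    -- Otherwise `f` would carry the 3-arc that lies on a decagon to the one that does not.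
    · have := (onDecagon hm hl x).map f
      rw [hfa, hfb, hfc, h] at this
      exact absurd this (not_onDecagon hm hl hgen hperf x)
    · exact h
  have htrue : f (vertex m l (turn m l true * y)) = vertex m l (turn m l true * y) := by
    rcases hnb.mp (hadj (hnb.mpr (Or.inr (Or.inl rfl)))) with h | h | h
    · rw [hgy, ← hfb] at h
      have := f.injective h
      rw [← hgy] at this
      exact absurd this (turn_ne_gElt _ _)
    · exact h
    · rw [← hfalse] at h
      exact absurd (f.injective h) (turn_true_ne_turn_false _)
  rcases hnb.mp hcd with rfl | rfl | rfl
  · rw [hgy, hfb]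
  · exact htrue
  · exact hfalse

theorem eq_one_of_fixes_two_arc (f : coverGraph hm l ≃g coverGraph hm l)
    {a b c : RightCosets (HSub m l)} (hab : (coverGraph hm l).Adj a b)
    (hbc : (coverGraph hm l).Adj b c) (hac : a ≠ c) (hfa : f a = a) (hfb : f b = b)
    (hfc : f c = c) : f = 1 := by
  have hstep (u w : RightCosets (HSub m l)) (huw : (coverGraph hm l).Adj u w)
      (hu : f u = u ∧ ∀ d, (coverGraph hm l).Adj u d → f d = d) :
      f w = w ∧ ∀ d, (coverGraph hm l).Adj w d → f d = d := by
    refine ⟨hu.2 w huw, fun d hd => ?_⟩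
    -- A second neighbour `t` of `u` makes `t, u, w` a fixed 2-arc, so the neighbours of `w` are
    -- fixed too.
    obtain ⟨t, ht, htw⟩ : ∃ t ∈ (coverGraph hm l).neighborSet u, t ≠ w := by
      refine Set.exists_ne_of_one_lt_ncard ?_ w
      rw [ncard_neighborSet hm hl]
      norm_num
    exact fixes_of_fixes_two_arc hm hl hgen hperf f (SimpleGraph.Adj.symm ht) huw htw
      (hu.2 t ht) hu.1 (hu.2 w huw) hd
  have hc : f c = c ∧ ∀ d, (coverGraph hm l).Adj c d → f d = d :=
    ⟨hfc, fun d hd => fixes_of_fixes_two_arc hm hl hgen hperf f hab hbc hac hfa hfb hfc hd⟩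
  have hall (w : RightCosets (HSub m l)) :
      f w = w ∧ ∀ d, (coverGraph hm l).Adj w d → f d = d := by
    obtain ⟨p⟩ := (coverGraph_connected hm hl hgen hperf).preconnected c w
    clear hab hbc hac hfa hfb hfc
    induction p with
    | nil => exact hc
    | cons h p ih => exact ih (hstep _ _ h hc)
  ext w
  exact (hall w).1

omit hgen hperf in
-- An element of the kernel lies in `H` and fixes all pairs, so its permutation is trivial; and `H`
-- embeds in A₅.
theorem coverAction_injective : Function.Injective (coverAction hm l) := by
  rw [injective_iff_map_eq_one]
  intro z hz
  have hv (x : Wreath P) : vertex m l (x * z⁻¹) = vertex m l x := by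
    rw [← coverAction_vertex hm, hz]
    rfl
  have hz1 : z.right = 1 := by
    have key : ∀ σ : alternatingGroup (Fin 5),
        (∀ s : Finset (Fin 5), s.card = 2 → σ • s = s) → σ = 1 := by
      decide +kernel
    refine key _ fun s hs => ?_
    obtain ⟨σ, rfl⟩ := exists_smul_eq_of_card_eq_two s hs
    have := congrArg (fun a => (pairOf a).1) (hv (SemidirectProduct.inr σ⁻¹))
    simpa [pairOf_vertex, mul_smul] using this
  have hzH : z ∈ HSub m l := by
    have := vertex_eq_iff.mp (hv 1)
    simpa using this
  obtain ⟨y, hy, h⟩ :=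
    (mem_HSub_iff (mul_self_of_orderOf hm) (mul_self_mul_of_orderOf hl)).mp hzH
  rcases hy with rfl | rfl | rfl <;> rcases h with rfl | rfl
  · rfl
  · exact absurd (show c12c45⁻¹ * 1 = 1 from hz1) (by decide)
  · exact absurd (show c123⁻¹ = 1 from hz1) (by decide)
  · exact absurd (show c12c45⁻¹ * c123⁻¹ = 1 from hz1) (by decide)
  · exact absurd (show c123⁻¹⁻¹ = 1 from hz1) (by decide)
  · exact absurd (show c12c45⁻¹ * c123⁻¹⁻¹ = 1 from hz1) (by decide)

/-- By 2-arc-transitivity some element of `G` agrees with `f` on a 2-arc, and an automorphism is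
determined by its values there. -/
theorem coverAction_surjective : Function.Surjective (coverAction hm l) := by
  intro f
  set a : Fin 3 → RightCosets (HSub m l) :=
    ![vertex m l 1, vertex m l (gElt m * 1), vertex m l (turn m l true * (gElt m * 1))] with ha
  have h01 : (coverGraph hm l).Adj (a 0) (a 1) :=
    (adj_vertex_iff hm hl _ _).mpr (Or.inl rfl)
  have h12 : (coverGraph hm l).Adj (a 1) (a 2) :=
    (adj_vertex_iff hm hl _ _).mpr (Or.inr (Or.inl rfl))
  have hg : gElt m * gElt m = 1 := gElt_mul_self hm
  have h02 : a 0 ≠ a 2 := by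
    have := turn_ne_gElt (m := m) (l := l) true (gElt m * 1)
    rw [← mul_assoc (gElt m), hg, one_mul] at this
    exact this.symm
  have hS : IsSArc (coverGraph hm l) 2 a := by
    refine ⟨fun i => ?_, fun i j hij => ?_⟩
    · fin_cases i
      exacts [h01, h12]
    · obtain rfl : i = 0 := Fin.ext (by change (i : ℕ) = 0; omega)
      obtain rfl : j = 2 := Fin.ext hij
      exact h02
  have hSf : IsSArc (coverGraph hm l) 2 fun i => f (a i) :=
    ⟨fun i => f.map_rel_iff.mpr (hS.1 i), fun i j hij h => hS.2 i j hij (f.injective h)⟩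
  obtain ⟨_, ⟨z, rfl⟩, hz⟩ := isSArcTransitive_two hm hl _ _ hS hSf
  refine ⟨z, ?_⟩
  have hfix (i : Fin 3) : (f⁻¹ * coverAction hm l z) (a i) = a i := by
    change f.symm (coverAction hm l z (a i)) = a i
    rw [hz i]
    exact f.symm_apply_apply _
  have := eq_one_of_fixes_two_arc hm hl hgen hperf (f⁻¹ * coverAction hm l z) h01 h12 h02
    (hfix 0) (hfix 1) (hfix 2)
  exact (inv_mul_eq_one.mp this).symm

end Automorphisms

/-! ### `Γ` is not a Cayley graph -/

section Cayley

variable {P : Type u} [Group P] {m l : P}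

theorem exists_commutator_eq_c12c45 : ∃ a b : alternatingGroup (Fin 5),
    a * b * a⁻¹ * b⁻¹ = c12c45⁻¹ := by
  decide +kernel

/-- The coordinate subgroups are perfect and the permutation part is a commutator in A₅. This will
be applied to the sign of a permutation action. -/
theorem map_h₂_eq_one {A : Type v} [CommGroup A] (hperf : commutator P = ⊤) (f : Wreath P →* A) :
    f (h₂ m) = 1 := by
  have hinl (t : Fin 5 → P) : f (SemidirectProduct.inl t) = 1 := by
    have : t ∈ (f.comp SemidirectProduct.inl).ker := by
      refine Subgroup.pi_mem_of_mulSingle_mem t fun i => ?_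
      have hP := Abelianization.commutator_subset_ker
        ((f.comp SemidirectProduct.inl).comp (MonoidHom.mulSingle (fun _ : Fin 5 => P) i))
      rw [hperf] at hP
      exact hP (Subgroup.mem_top (t i))
    exact this
  have hinr : f (SemidirectProduct.inr c12c45⁻¹) = 1 := by
    obtain ⟨a, b, hab⟩ := exists_commutator_eq_c12c45
    rw [← hab]
    simp only [map_mul, map_inv]
    rw [mul_right_comm, mul_inv_cancel_right, mul_inv_cancel]
  rw [h₂, wr, SemidirectProduct.mk_eq_inl_mul_inr, map_mul, hinl, hinr, one_mul]

/-- The elements of `H`, as pairs consisting of a power of `h₁` and a power of `h₂`. -/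
def elementOf (m l : P) (p : Fin 3 × Bool) : Wreath P :=
  cond p.2 (h₂ m) 1 * ![1, h₁ l, (h₁ l)⁻¹] p.1

theorem elementOf_mem (p : Fin 3 × Bool) : elementOf m l p ∈ HSub m l := by
  refine mul_mem ?_ ?_
  · cases p.2
    exacts [one_mem _, h₂_mem m l]
  · generalize p.1 = i
    fin_cases i
    exacts [one_mem _, h₁_mem m l, inv_mem (h₁_mem m l)]

theorem elementOf_injective : Function.Injective (elementOf m l) := by
  have hr (p : Fin 3 × Bool) : (elementOf m l p).right =
      cond p.2 c12c45⁻¹ 1 * ![1, c123⁻¹, c123⁻¹⁻¹] p.1 := by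
    rcases p with ⟨i, _ | _⟩ <;> fin_cases i <;> rfl
  have hinj : ∀ p q : Fin 3 × Bool, cond p.2 c12c45⁻¹ 1 * ![1, c123⁻¹, c123⁻¹⁻¹] p.1 =
      cond q.2 c12c45⁻¹ 1 * ![1, c123⁻¹, c123⁻¹⁻¹] q.1 → p = q := by
    decide +kernel
  intro p q h
  refine hinj p q ?_
  rw [← hr, ← hr, h]

theorem exists_elementOf_eq (hm : m * m = 1) (hl : l * l * l = 1) {h : Wreath P}
    (hh : h ∈ HSub m l) : ∃ p, elementOf m l p = h := by
  obtain ⟨y, hy, h'⟩ := (mem_HSub_iff hm hl).mp hh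
  rcases hy with rfl | rfl | rfl <;> rcases h' with rfl | rfl
  exacts [⟨(0, false), one_mul _⟩, ⟨(0, true), rfl⟩, ⟨(1, false), one_mul _⟩, ⟨(1, true), rfl⟩,
    ⟨(2, false), one_mul _⟩, ⟨(2, true), rfl⟩]

/-- `H` has no complement in `G`: on the cosets of a complement, `h₂` would induce an odd
permutation. -/
theorem not_exists_complement (hperf : commutator P = ⊤) (hm : m * m = 1) (hl : l * l * l = 1)
    (R : Subgroup (Wreath P)) (h1 : ∀ z ∈ R, z ∈ HSub m l → z = 1)
    (h2 : ∀ z : Wreath P, ∃ h ∈ HSub m l, h * z ∈ R) : False := by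
  -- The elements of `H` represent the cosets of its complement `R`. Left multiplication by `h₂`
  -- then only flips the exponent of `h₂`, giving three transpositions.
  let E : Fin 3 × Bool ≃ Wreath P ⧸ R :=
    Equiv.ofBijective (fun p => (elementOf m l p : Wreath P ⧸ R)) <| by
      constructor
      · intro p q h
        have hR := QuotientGroup.eq.mp h
        have := h1 _ hR (mul_mem (inv_mem (elementOf_mem p)) (elementOf_mem q))
        exact elementOf_injective (inv_mul_eq_one.mp this)
      · intro a
        obtain ⟨z, rfl⟩ := QuotientGroup.mk_surjective a
        obtain ⟨h, hh, hz⟩ := h2 z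
        obtain ⟨p, hp⟩ := exists_elementOf_eq hm hl (inv_mem hh)
        refine ⟨p, QuotientGroup.eq.mpr ?_⟩
        rwa [hp, inv_inv]
  let τ : Equiv.Perm (Fin 3 × Bool) := Equiv.prodCongr (Equiv.refl _) Equiv.boolNot
  let ρ : Wreath P →* Equiv.Perm (Fin 3 × Bool) :=
    E.symm.permCongrHom.toMonoidHom.comp (MulAction.toPermHom (Wreath P) (Wreath P ⧸ R))
  have hρ : ρ (h₂ m) = τ := by
    ext1 p
    change E.symm (h₂ m • E p) = τ p
    rw [Equiv.symm_apply_eq]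
    change ((h₂ m * elementOf m l p : Wreath P) : Wreath P ⧸ R) =
      (elementOf m l (τ p) : Wreath P ⧸ R)
    rcases p with ⟨i, _ | _⟩
    · congr 1
      simp [elementOf, τ]
    · congr 1
      simp [elementOf, τ, mul_self_assoc (h₂_mul_h₂ hm hl)]
  have hs := map_h₂_eq_one (m := m) hperf (Equiv.Perm.sign.comp ρ)
  rw [MonoidHom.comp_apply, hρ] at hs
  have hτ : Equiv.Perm.sign τ = -1 := by decide +kernel
  rw [hτ] at hs
  exact absurd hs (by decide)

/-- Left translations of the Cayley group form a regular group of automorphisms. Since `Aut Γ = G`,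
they come from a subgroup `R` of `G`: semiregularity gives `R ∩ H = 1` and transitivity gives `H R =
G`. -/
theorem not_isCayleyGraph (hm : orderOf m = 2) (hl : orderOf l = 3)
    (hgen : Subgroup.closure {m, l} = (⊤ : Subgroup P)) (hperf : commutator P = ⊤) :
    ¬ IsCayleyGraph (coverGraph hm l) := by
  rintro ⟨K, _, S, ⟨e⟩⟩
  let R : Subgroup (Wreath P) :=
    { carrier := {z | ∃ k : K, ∀ a, e (coverAction hm l z a) = k * e a}
      one_mem' := ⟨1, fun a => by rw [map_one, one_mul]; rfl⟩
      mul_mem' := by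
        rintro z w ⟨k, hk⟩ ⟨j, hj⟩
        refine ⟨k * j, fun a => ?_⟩
        rw [map_mul, mul_assoc, ← hj, ← hk]
        rfl
      inv_mem' := by
        rintro z ⟨k, hk⟩
        refine ⟨k⁻¹, fun a => ?_⟩
        rw [eq_inv_mul_iff_mul_eq, ← hk, map_inv]
        exact congrArg e ((coverAction hm l z).apply_symm_apply a) }
  refine not_exists_complement hperf (mul_self_of_orderOf hm) (mul_self_mul_of_orderOf hl) R ?_ ?_
  · rintro z ⟨k, hk⟩ hz
    have hfix : coverAction hm l z (vertex m l 1) = vertex m l 1 := by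
      rw [coverAction_vertex, one_mul, ← mul_one z⁻¹, vertex_mul (inv_mem hz)]
    have hk1 : k = 1 := by
      have := hk (vertex m l 1)
      rw [hfix] at this
      exact mul_eq_right.mp this.symm
    refine coverAction_injective hm hl ?_
    rw [map_one]
    ext a
    have := hk a
    rw [hk1, one_mul] at this
    exact e.injective this
  · intro z
    -- Left translation by `k` takes the vertex `H` to `H z`.
    set k := e (vertex m l z) * (e (vertex m l 1))⁻¹ with hk
    let L : SimpleGraph.mulCayley S ≃g SimpleGraph.mulCayley S :=
      { Equiv.mulLeft k with
        map_rel_iff' := by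
          intro a b
          simp [SimpleGraph.mulCayley_adj', mul_assoc] }
    obtain ⟨r, hr⟩ := coverAction_surjective hm hl hgen hperf ((e.trans L).trans e.symm)
    have hra (a : RightCosets (HSub m l)) : e (coverAction hm l r a) = k * e a := by
      rw [hr]
      exact e.apply_symm_apply _
    have hv : vertex m l z = vertex m l r⁻¹ := by
      apply e.injective
      have := hra (vertex m l 1)
      rw [coverAction_vertex, one_mul] at this
      rw [this, hk, inv_mul_cancel_right]
    refine ⟨r⁻¹ * z⁻¹, vertex_eq_iff.mp hv, ?_⟩
    rw [inv_mul_cancel_right]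
    exact R.inv_mem ⟨k, hra⟩

end Cayley

end PetersenCover


theorem theorem1p2 {P : Type*} [Group P] (m l : P)
    (hm : orderOf m = 2) (hl : orderOf l = 3)
    (hgen : Subgroup.closure {m, l} = (⊤ : Subgroup P))
    (hperf : commutator P = ⊤) :
    -- `Γ` is connected and cubic
    (PetersenCover.coverGraph hm l).Connected ∧
    (∀ x, ((PetersenCover.coverGraph hm l).neighborSet x).ncard = 3) ∧
    -- `Γ` is `(G, 2)`-arc-transitive
    PetersenCover.IsSArcTransitive (PetersenCover.coverGraph hm l)
      (PetersenCover.coverAction hm l).range 2 ∧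
    -- `Γ` is a normal cover of the Petersen graph, with transformation group `P⁵`
    PetersenCover.IsNormalCover (PetersenCover.coverGraph hm l)
      (PetersenCover.coverAction hm l).range
      ((PetersenCover.baseGroup P).map (PetersenCover.coverAction hm l))
      PetersenCover.petersenGraph ∧
    -- `Aut Γ = G`: the action of `G` is faithful and gives every automorphism
    Function.Bijective (PetersenCover.coverAction hm l) ∧
    -- `Γ` is not a Cayley graph
    ¬ PetersenCover.IsCayleyGraph (PetersenCover.coverGraph hm l) ∧
    -- `Γ` has girth `10`
    (PetersenCover.coverGraph hm l).egirth = 10 :=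
  ⟨PetersenCover.coverGraph_connected hm hl hgen hperf, PetersenCover.ncard_neighborSet hm hl,
    PetersenCover.isSArcTransitive_two hm hl, PetersenCover.isNormalCover_petersenGraph hm hl,
    ⟨PetersenCover.coverAction_injective hm hl,
      PetersenCover.coverAction_surjective hm hl hgen hperf⟩,
    PetersenCover.not_isCayleyGraph hm hl hgen hperf,
    PetersenCover.egirth_coverGraph hm hl hgen hperf⟩
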